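/- Let $(M,g)$ be a smooth Lorentz 4-manifold of signature $(-,+,+,+)$ which is a Yang Pure Space, i.e. its Ricci tensor satisfies $\nabla_aR_{bc}-\nabla_bR_{ac}=0$. Suppose that the scalar curvature $R$ vanishes and that the Ricci tensor has Segré type $\{(1,1)(11)\}$ everywhere: at each point there is a pseudo-orthonormal basis $u,v_2,v_3,v_4$ ($u$ timelike) of eigenvectors of $R^a{}_b$ such that $u,v_2$ have a common eigenvalue $\rho$ and $v_3,v_4$ have a common eigenvalue $\sigma\neq\rho$. Then: 1. If the energy condition $R_{ab}t^at^b\ge 0$ holds for all timelike vectors $t$, then $(M,g)$ is (locally) a non-null Einstein–Maxwell space-time: every point has a neighbourhood with a smooth two-form $F_{ab}$ whose invariants $F_{ab}F^{ab}$ and $F_{ab}{}^*F^{ab}$ do not both vanish at any point, such that $\nabla_{[a}F_{bc]}=0$, $\nabla^aF_{ab}=0$ and $R_{ab}-\frac12Rg_{ab}=8\pi T_{ab}$, where $T_{ab}=F_{ac}F_b{}^c-\frac14F_{cd}F^{cd}g_{ab}$. 2. (Without the energy condition.) $(M,g)$ satisfies the algebraic Rainich condition $R_{ab}R^b{}_c=\frac14g_{ac}R_{bd}R^{bd}\neq0$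 and the analytic Rainich condition $\nabla_{[a}\alpha_{b]}=0$, where $\alpha_b=(R_{cd}R^{cd})^{-1}\epsilon_{bgef}R^g{}_h\nabla^fR^{he}$. 3. (Without the energy condition.) $(M,g)$ is conformally flat, in the sense that its Weyl tensor vanishes. 4. (Without the energy condition.) $(M,g)$ lies in Kundt's class: every point has a neighbourhood with a smooth nowhere zero null vector field $k^a$ that is tangent to a geodesic, shear-free, twist-free and expansion-free congruence; equivalently, $X^aY^b\nabla_bk_a=0$ for all vectors $X,Y$ orthogonal to $k$. -/

import Mathlib

open scoped Manifold ContDiff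

noncomputable section

namespace YangPure

/-- The coordinate space `ℝ⁴`, on which four-dimensional manifolds are modelled. -/
abbrev Coord := EuclideanSpace ℝ (Fin 4)

/-! ### Tensor calculus in a coordinate system

Throughout, `G y` is the matrix of components `g_ab` of a Lorentz metric at the coordinate point
`y`. Index conventions: `R^a_{bcd} = ∂_c Γ^a_{db} - ∂_d Γ^a_{cb} + …`, `R_{bd} = R^a_{bad}`,
signature `(-,+,+,+)`. -/

/-- The partial derivative `∂_a f`. -/
def pd (a : Fin 4) (f : Coord → ℝ) (y : Coord) : ℝ :=
  fderiv ℝ f y (EuclideanSpace.single a 1)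

/-- The Minkowski matrix `diag(-1, 1, 1, 1)`. -/
def eta : Matrix (Fin 4) (Fin 4) ℝ := Matrix.diagonal ![-1, 1, 1, 1]

section Coordinates

variable (G : Coord → Matrix (Fin 4) (Fin 4) ℝ)

/-- The inverse metric `g^{ab}`. -/
def ginv (y : Coord) : Matrix (Fin 4) (Fin 4) ℝ := (G y)⁻¹

/-- The Christoffel symbol `Γ^a_{bc}` of the Levi-Civita connection. -/
def christoffel (a b c : Fin 4) (y : Coord) : ℝ :=
  (1 / 2) * ∑ d, ginv G y a d *
    (pd b (fun z => G z c d) y + pd c (fun z => G z b d) y - pd d (fun z => G z b c) y)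

/-- The Riemann tensor `R^a_{bcd}`. -/
def riemannUp (a b c d : Fin 4) (y : Coord) : ℝ :=
  pd c (christoffel G a d b) y - pd d (christoffel G a c b) y
    + ∑ e, (christoffel G a c e y * christoffel G e d b y
      - christoffel G a d e y * christoffel G e c b y)

/-- The Riemann tensor with all indices down, `R_{abcd}`. -/
def riemann (a b c d : Fin 4) (y : Coord) : ℝ := ∑ e, G y a e * riemannUp G e b c d y

/-- The Ricci tensor `R_{ab}`. -/
def ricci (a b : Fin 4) (y : Coord) : ℝ := ∑ c, riemannUp G c a c b y

/-- The Ricci tensor `R^a_b`, as an endomorphism. -/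
def ricciMixed (a b : Fin 4) (y : Coord) : ℝ := ∑ c, ginv G y a c * ricci G c b y

/-- The scalar curvature `R`. -/
def scalarCurv (y : Coord) : ℝ := ∑ a, ∑ b, ginv G y a b * ricci G a b y

/-- The square `R_{ab} R^{ab}`. -/
def ricciSq (y : Coord) : ℝ := ∑ a, ∑ b, ricciMixed G a b y * ricciMixed G b a y

/-- The Weyl conformal curvature tensor `C_{abcd}` in dimension four. -/
def weyl (a b c d : Fin 4) (y : Coord) : ℝ :=
  riemann G a b c d y
    - (1 / 2) * (G y a c * ricci G b d y - G y a d * ricci G b c y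
      - G y b c * ricci G a d y + G y b d * ricci G a c y)
    + (scalarCurv G y / 6) * (G y a c * G y b d - G y a d * G y b c)

/-- The covariant derivative `∇_a w_b` of a covector field. -/
def covD1 (w : Fin 4 → Coord → ℝ) (a b : Fin 4) (y : Coord) : ℝ :=
  pd a (w b) y - ∑ c, christoffel G c a b y * w c y

/-- The covariant derivative `∇_a T_{bc}` of a twice covariant tensor field. -/
def covD2 (T : Fin 4 → Fin 4 → Coord → ℝ) (a b c : Fin 4) (y : Coord) : ℝ :=
  pd a (T b c) y - ∑ d, christoffel G d a b y * T d c y - ∑ d, christoffel G d a c y * T b d y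

/-- The Levi-Civita symbol `[abcd]`, with `[0123] = 1`: the determinant of the matrix whose rows
are the unit vectors numbered `a, b, c, d`. -/
def leviCivitaSymbol (a b c d : Fin 4) : ℝ :=
  Matrix.det (Matrix.of fun i j : Fin 4 => if ![a, b, c, d] i = j then (1 : ℝ) else 0)

/-- The volume form `ε_{abcd} = √|det g| [abcd]` for the orientation of the coordinate system. -/
def volForm (a b c d : Fin 4) (y : Coord) : ℝ :=
  Real.sqrt |(G y).det| * leviCivitaSymbol a b c d

/-- `T^{ab}`: both indices raised. -/
def raise2 (T : Fin 4 → Fin 4 → Coord → ℝ) (a b : Fin 4) (y : Coord) : ℝ :=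
  ∑ c, ∑ d, ginv G y a c * ginv G y b d * T c d y

/-- Yang's equations `∇_a R_{bc} - ∇_b R_{ac} = 0` at `y`. -/
def YangAt (y : Coord) : Prop :=
  ∀ a b c, covD2 G (ricci G) a b c y - covD2 G (ricci G) b a c y = 0

/-- The Ricci tensor has Segré type `{(1,1)(11)}` at `y`: there is a pseudo-orthonormal basis
`v 0` (timelike), `v 1, v 2, v 3` (spacelike) of eigenvectors, where `v 0, v 1` share an eigenvalue
`ρ`, and `v 2, v 3` share a different eigenvalue `σ`. -/
def SegreAt (y : Coord) : Prop :=
  ∃ (v : Fin 4 → Fin 4 → ℝ) (ρ σ : ℝ), ρ ≠ σ ∧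
    (∀ i j, ∑ a, ∑ b, G y a b * v i a * v j b = eta i j) ∧
    (∀ i a, ∑ b, ricciMixed G a b y * v i b = (![ρ, ρ, σ, σ] i) * v i a)

/-- The weak energy condition for the Ricci tensor at `y`: `R_{ab} t^a t^b ≥ 0` for all timelike
`t`. -/
def EnergyAt (y : Coord) : Prop :=
  ∀ t : Fin 4 → ℝ, ∑ a, ∑ b, G y a b * t a * t b < 0 →
    0 ≤ ∑ a, ∑ b, ricci G a b y * t a * t b

/-- The algebraic Rainich condition `R_{ab} R^b_c = (1/4) g_{ac} R_{bd} R^{bd} ≠ 0` at `y`. -/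
def RainichAlgebraicAt (y : Coord) : Prop :=
  (∀ a c, ∑ b, ricci G a b y * ricciMixed G b c y = (1 / 4) * G y a c * ricciSq G y) ∧
    ricciSq G y ≠ 0

/-- The Rainich covector
`α_b = (R_{cd} R^{cd})⁻¹ ε_{bgef} R^g_h ∇^f R^{he}`. -/
def rainichCovector (b : Fin 4) (y : Coord) : ℝ :=
  (ricciSq G y)⁻¹ * ∑ g, ∑ e, ∑ f, ∑ h, volForm G b g e f y * ricciMixed G g h y *
    ∑ f', ∑ h', ∑ e', ginv G y f f' * ginv G y h h' * ginv G y e e' *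
      covD2 G (ricci G) f' h' e' y

/-- The analytic Rainich condition `∇_{[a} α_{b]} = 0` at `y`. -/
def RainichAnalyticAt (y : Coord) : Prop :=
  ∀ a b, covD1 G (rainichCovector G) a b y - covD1 G (rainichCovector G) b a y = 0

/-- The invariant `F_{ab} F^{ab}`. -/
def fieldSq (F : Fin 4 → Fin 4 → Coord → ℝ) (y : Coord) : ℝ :=
  ∑ a, ∑ b, F a b y * raise2 G F a b y

/-- The invariant `F_{ab} (*F)^{ab}`, that is `(1/2) ε_{abcd} F^{ab} F^{cd}`. -/
def fieldDualSq (F : Fin 4 → Fin 4 → Coord → ℝ) (y : Coord) : ℝ :=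
  (1 / 2) * ∑ a, ∑ b, ∑ c, ∑ d, volForm G a b c d y * raise2 G F a b y * raise2 G F c d y

/-- The electromagnetic energy-momentum tensor
`T_{ab} = F_{ac} F_b^c - (1/4) F_{cd} F^{cd} g_{ab}`. -/
def emTensor (F : Fin 4 → Fin 4 → Coord → ℝ) (a b : Fin 4) (y : Coord) : ℝ :=
  ∑ c, ∑ d, ginv G y c d * F a c y * F b d y - (1 / 4) * fieldSq G F y * G y a b

/-- The source-free Maxwell equations `∇_{[a} F_{bc]} = 0`, `∇^a F_{ab} = 0` at `y`. -/
def MaxwellAt (F : Fin 4 → Fin 4 → Coord → ℝ) (y : Coord) : Prop :=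
  (∀ a b c, covD2 G F a b c y + covD2 G F b c a y + covD2 G F c a b y = 0) ∧
    (∀ b, ∑ a, ∑ c, ginv G y a c * covD2 G F c a b y = 0)

/-- Einstein's equation `R_{ab} - (1/2) R g_{ab} = 8π T_{ab}` with electromagnetic source `F`. -/
def EinsteinAt (F : Fin 4 → Fin 4 → Coord → ℝ) (y : Coord) : Prop :=
  ∀ a b, ricci G a b y - (1 / 2) * scalarCurv G y * G y a b = 8 * Real.pi * emTensor G F a b y

/-- On the open set `V`, `F` is a smooth two-form which is nowhere null (its two scalar invariants
have no common zero) and solves the Einstein–Maxwell equations. -/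
structure IsNonNullEinsteinMaxwellField (F : Fin 4 → Fin 4 → Coord → ℝ) (V : Set Coord) :
    Prop where
  smooth : ∀ a b, ContDiffOn ℝ ∞ (F a b) V
  antisymm : ∀ y ∈ V, ∀ a b, F a b y = -F b a y
  nonNull : ∀ y ∈ V, fieldSq G F y ≠ 0 ∨ fieldDualSq G F y ≠ 0
  maxwell : ∀ y ∈ V, MaxwellAt G F y
  einstein : ∀ y ∈ V, EinsteinAt G F y

/-- The covariant components `k_a` of a vector field. -/
def lower (k : Fin 4 → Coord → ℝ) (a : Fin 4) (y : Coord) : ℝ := ∑ b, G y a b * k b y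

/-- On the open set `V`, `k` is a smooth nowhere zero null vector field that is tangent to a
geodesic, shear-free, twist-free and expansion-free congruence: `X^a Y^b ∇_b k_a = 0` for all
vectors `X, Y` orthogonal to `k`. In a null tetrad `(k, n, m, m̄)` this says that the spin
coefficients `κ = k_{a;b} m^a k^b` (geodesy), `σ = k_{a;b} m^a m^b` (shear) and
`ρ = k_{a;b} m^a m̄^b` (expansion and twist) vanish; no affine parametrization is imposed. -/
structure IsKundtField (k : Fin 4 → Coord → ℝ) (V : Set Coord) : Prop where
  smooth : ∀ a, ContDiffOn ℝ ∞ (k a) V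
  ne_zero : ∀ y ∈ V, ∃ a, k a y ≠ 0
  isNull : ∀ y ∈ V, ∑ a, lower G k a y * k a y = 0
  kundt : ∀ y ∈ V, ∀ X Y : Fin 4 → ℝ,
    ∑ a, lower G k a y * X a = 0 → ∑ a, lower G k a y * Y a = 0 →
      ∑ a, ∑ b, covD1 G (lower G k) b a y * X a * Y b = 0

end Coordinates

/-! ### Lorentz four-manifolds -/

section Manifold

variable {M : Type*} [TopologicalSpace M] [ChartedSpace Coord M]

/-- The components in the chart `e` of a field `g` of bilinear forms on the tangent spaces of `M`:
`g_ab` at `y` is the value at `e⁻¹(y)` on the coordinate vectors `∂_a, ∂_b`. -/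
def chartComponents
    (g : ∀ x : M, TangentSpace (𝓡 4) x →ₗ[ℝ] TangentSpace (𝓡 4) x →ₗ[ℝ] ℝ)
    (e : OpenPartialHomeomorph M Coord) (y : Coord) : Matrix (Fin 4) (Fin 4) ℝ :=
  Matrix.of fun a b =>
    g (e.symm y)
      (mfderiv (𝓡 4) (𝓡 4) e.symm y (EuclideanSpace.single a (1 : ℝ) : Coord))
      (mfderiv (𝓡 4) (𝓡 4) e.symm y (EuclideanSpace.single b (1 : ℝ) : Coord))

variable (M) in
/-- A smooth Lorentz metric, of signature `(-,+,+,+)`, on a smooth four-manifold. -/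
structure LorentzMetric where
  /-- The bilinear form on each tangent space. -/
  form : ∀ x : M, TangentSpace (𝓡 4) x →ₗ[ℝ] TangentSpace (𝓡 4) x →ₗ[ℝ] ℝ
  symm : ∀ (x : M) (v w : TangentSpace (𝓡 4) x), form x v w = form x w v
  lorentz : ∀ x : M, ∃ b : Module.Basis (Fin 4) ℝ (TangentSpace (𝓡 4) x),
    ∀ i j, form x (b i) (b j) = eta i j
  smooth : ∀ e ∈ IsManifold.maximalAtlas (𝓡 4) ∞ M, ∀ a b,
    ContDiffOn ℝ ∞ (fun y => chartComponents form e y a b) e.target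

namespace LorentzMetric

variable (g : LorentzMetric M)

/-- The metric components in a chart. -/
def inChart (e : OpenPartialHomeomorph M Coord) : Coord → Matrix (Fin 4) (Fin 4) ℝ :=
  chartComponents g.form e

/-- A pointwise condition on metric components holds at all points of `M`, in all charts of the
maximal smooth atlas. -/
def Everywhere (P : (Coord → Matrix (Fin 4) (Fin 4) ℝ) → Coord → Prop) : Prop :=
  ∀ e ∈ IsManifold.maximalAtlas (𝓡 4) ∞ M, ∀ y ∈ e.target, P (g.inChart e) y

/-- A condition on metric components and an open coordinate set holds on some neighbourhood of each
point of `M`, in all charts of the maximal smooth atlas. -/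
def Locally (P : (Coord → Matrix (Fin 4) (Fin 4) ℝ) → Set Coord → Prop) : Prop :=
  ∀ e ∈ IsManifold.maximalAtlas (𝓡 4) ∞ M, ∀ y ∈ e.target,
    ∃ V : Set Coord, IsOpen V ∧ y ∈ V ∧ V ⊆ e.target ∧ P (g.inChart e) V

/-- Yang Pure Space: Yang's equations hold. -/
def IsYangPureSpace : Prop := g.Everywhere YangAt

/-- The scalar curvature vanishes. -/
def IsScalarFlat : Prop := g.Everywhere fun G y => scalarCurv G y = 0

/-- The Ricci tensor has Segré type `{(1,1)(11)}` everywhere. -/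
def HasSegreType : Prop := g.Everywhere SegreAt

/-- The Ricci tensor is nonnegative on timelike vectors. -/
def EnergyCondition : Prop := g.Everywhere EnergyAt

/-- The algebraic and the analytic Rainich conditions hold. -/
def SatisfiesRainichConditions : Prop :=
  g.Everywhere RainichAlgebraicAt ∧ g.Everywhere RainichAnalyticAt

/-- Conformal flatness: the Weyl tensor vanishes. -/
def IsConformallyFlat : Prop := g.Everywhere fun G y => ∀ a b c d, weyl G a b c d y = 0

/-- Non-null Einstein–Maxwell space-time: around each point there is a non-null electromagnetic
field that solves the Einstein–Maxwell equations. -/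
def IsNonNullEinsteinMaxwell : Prop :=
  g.Locally fun G V => ∃ F, IsNonNullEinsteinMaxwellField G F V

/-- Kundt's class: around each point there is a null geodesic congruence without shear, twist and
expansion. -/
def IsKundt : Prop := g.Locally fun G V => ∃ k, IsKundtField G k V

end LorentzMetric

end Manifold

end YangPure

end

/-! Since R = 0, the two Ricci eigenvalues are ρ and -ρ with ρ ≠ 0, so the Ricci endomorphism S
satisfies S² = ρ²·1, which is the algebraic Rainich condition. Yang's equations make T = ∇Ric
totally symmetric. Differentiating S² = ρ²·1 gives, in an eigenframe, T_ijk (ρ_j + ρ_k) = K_i η_jk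
with K = d(ρ²). Hence T_ijk = 0 whenever j ≠ k lie in the same eigenplane; together with the
symmetry of T this forces K = 0 and then T_ijj = 0. Of any three indices two lie in one eigenplane,
so T = 0 (`codazzi_eq_zero`). Thus Ric is parallel, ρ² is locally constant, and the Rainich covector
vanishes.

By the Ricci identity the curvature commutes with S and so preserves both eigenplanes. The Bianchi
identity leaves only the two sectional components R_0101 and R_2323, which Ric determines
(`curvature_of_blocks`); the result has no Weyl part. Geometrically this is locally a product of two
surfaces of opposite constant curvature, but no product decomposition is needed.

Let P be the parallel projection onto the timelike eigenplane. This plane carries an infinitesimal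
boost J with J² = P, unique up to sign and therefore parallel (`IsBoostField.nablaEnd_eq_zero`).
Lowering an index gives a parallel, hence closed and coclosed, two-form whose stress tensor is
proportional to Ric; the energy condition supplies the sign ρ < 0 needed to normalize it. Finally J
+ P is parallel of rank one with null image, so a vector field (J + P)w satisfies ∇_b k ∝ k, which
is stronger than the Kundt condition. -/

noncomputable section

namespace YangPure

open scoped Matrix Topology

/-! ### Calculus of partial derivatives and of matrix fields -/

/-- Square matrices of size four. -/
abbrev Mat := Matrix (Fin 4) (Fin 4) ℝ

theorem pd_congr {a : Fin 4} {f h : Coord → ℝ} {y : Coord} (H : f =ᶠ[𝓝 y] h) :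
    pd a f y = pd a h y := by
  simp only [pd, H.fderiv_eq]

theorem pd_congr_of_isOpen {a : Fin 4} {f h : Coord → ℝ} {U : Set Coord} (hU : IsOpen U)
    (H : ∀ z ∈ U, f z = h z) {y : Coord} (hy : y ∈ U) : pd a f y = pd a h y :=
  pd_congr (Filter.eventuallyEq_of_mem (hU.mem_nhds hy) H)

theorem pd_const (a : Fin 4) (c : ℝ) (y : Coord) : pd a (fun _ => c) y = 0 := by
  simp [pd]

theorem pd_add {a : Fin 4} {f h : Coord → ℝ} {y : Coord} (hf : DifferentiableAt ℝ f y)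
    (hh : DifferentiableAt ℝ h y) : pd a (fun z => f z + h z) y = pd a f y + pd a h y := by
  simp [pd, fderiv_fun_add hf hh]

theorem pd_mul {a : Fin 4} {f h : Coord → ℝ} {y : Coord} (hf : DifferentiableAt ℝ f y)
    (hh : DifferentiableAt ℝ h y) :
    pd a (fun z => f z * h z) y = pd a f y * h y + f y * pd a h y := by
  simp [pd, fderiv_fun_mul hf hh]; ring

theorem pd_sum {ι : Type*} {s : Finset ι} {a : Fin 4} {f : ι → Coord → ℝ} {y : Coord}
    (hf : ∀ i ∈ s, DifferentiableAt ℝ (f i) y) :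
    pd a (fun z => ∑ i ∈ s, f i z) y = ∑ i ∈ s, pd a (f i) y := by
  simp [pd, fderiv_fun_sum hf]

theorem contDiffOn_pd {a : Fin 4} {f : Coord → ℝ} {U : Set Coord} (hU : IsOpen U)
    (hf : ContDiffOn ℝ ∞ f U) : ContDiffOn ℝ ∞ (pd a f) U := by
  have h := hf.fderiv_of_isOpen (m := ∞) hU (by simp)
  exact h.clm_apply contDiffOn_const

theorem pd_comm {a b : Fin 4} {f : Coord → ℝ} {U : Set Coord} (hU : IsOpen U)
    (hf : ContDiffOn ℝ ∞ f U) {y : Coord} (hy : y ∈ U) :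
    pd a (pd b f) y = pd b (pd a f) y := by
  have hfy : ContDiffAt ℝ ∞ f y := hf.contDiffAt (hU.mem_nhds hy)
  have hd : DifferentiableAt ℝ (fderiv ℝ f) y :=
    ((hf.fderiv_of_isOpen (m := ∞) hU (by simp)).contDiffAt (hU.mem_nhds hy)).differentiableAt
      (by simp)
  have hs : IsSymmSndFDerivAt ℝ f y := hfy.isSymmSndFDerivAt (by
    simpa using WithTop.coe_le_coe.2 (le_top (a := (2 : ℕ∞))))
  have key : ∀ v w : Coord, fderiv ℝ (fun z => fderiv ℝ f z v) y w = fderiv ℝ (fderiv ℝ f) y w v := by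
    intro v w
    rw [fderiv_clm_apply hd (differentiableAt_const v)]
    simp
  unfold pd
  rw [key, key]
  exact hs _ _

/-- All entries of a matrix field are smooth on `U`. -/
def SmoothOn (F : Coord → Mat) (U : Set Coord) : Prop :=
  ∀ i j, ContDiffOn ℝ ∞ (fun z => F z i j) U

/-- The entrywise partial derivative of a matrix field. -/
def pdM (a : Fin 4) (F : Coord → Mat) (y : Coord) : Mat :=
  Matrix.of fun i j => pd a (fun z => F z i j) y

theorem pdM_apply (a : Fin 4) (F : Coord → Mat) (y : Coord) (i j : Fin 4) :
    pdM a F y i j = pd a (fun z => F z i j) y := rfl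

theorem differentiableAt_of_contDiffOn {f : Coord → ℝ} {U : Set Coord} (hU : IsOpen U)
    (hf : ContDiffOn ℝ ∞ f U) {y : Coord} (hy : y ∈ U) : DifferentiableAt ℝ f y :=
  (hf.contDiffAt (hU.mem_nhds hy)).differentiableAt (by simp)

section

variable {U : Set Coord} {F H : Coord → Mat}

theorem SmoothOn.differentiableAt (hF : SmoothOn F U) (hU : IsOpen U) {y : Coord} (hy : y ∈ U)
    (i j : Fin 4) : DifferentiableAt ℝ (fun z => F z i j) y :=
  differentiableAt_of_contDiffOn hU (hF i j) hy

theorem SmoothOn.mono {V : Set Coord} (hF : SmoothOn F U) (h : V ⊆ U) : SmoothOn F V :=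
  fun i j => (hF i j).mono h

theorem SmoothOn.const (A : Mat) : SmoothOn (fun _ => A) U := fun _ _ => contDiffOn_const

theorem SmoothOn.add (hF : SmoothOn F U) (hH : SmoothOn H U) :
    SmoothOn (fun z => F z + H z) U := fun i j => (hF i j).add (hH i j)

theorem SmoothOn.sub (hF : SmoothOn F U) (hH : SmoothOn H U) :
    SmoothOn (fun z => F z - H z) U := fun i j => (hF i j).sub (hH i j)

theorem SmoothOn.smul {f : Coord → ℝ} (hf : ContDiffOn ℝ ∞ f U) (hH : SmoothOn H U) :
    SmoothOn (fun z => f z • H z) U := fun i j => hf.mul (hH i j)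

theorem SmoothOn.transpose (hF : SmoothOn F U) : SmoothOn (fun z => (F z)ᵀ) U :=
  fun i j => hF j i

theorem SmoothOn.mul (hF : SmoothOn F U) (hH : SmoothOn H U) :
    SmoothOn (fun z => F z * H z) U := fun i j => by
  simp only [Matrix.mul_apply]
  exact ContDiffOn.sum fun k _ => (hF i k).mul (hH k j)

theorem SmoothOn.trace (hF : SmoothOn F U) : ContDiffOn ℝ ∞ (fun z => (F z).trace) U := by
  simp only [Matrix.trace, Matrix.diag]
  exact ContDiffOn.sum fun k _ => hF k k

theorem SmoothOn.det (hF : SmoothOn F U) : ContDiffOn ℝ ∞ (fun z => (F z).det) U := by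
  simp only [Matrix.det_apply']
  exact ContDiffOn.sum fun σ _ => contDiffOn_const.mul (contDiffOn_prod fun i _ => hF _ _)

theorem SmoothOn.inv (hF : SmoothOn F U) (hdet : ∀ z ∈ U, (F z).det ≠ 0) :
    SmoothOn (fun z => (F z)⁻¹) U := fun i j => by
  -- Cramer's rule: each entry is a determinant with one row replaced, divided by `det F`.
  simp only [Matrix.inv_def, Ring.inverse_eq_inv', Matrix.smul_apply, smul_eq_mul,
    Matrix.adjugate_apply]
  refine (hF.det.inv hdet).mul (SmoothOn.det (F := fun z => (F z).updateRow j (Pi.single i 1)) ?_)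
  intro k l
  by_cases h : k = j
  · subst h; simpa using contDiffOn_const
  · simpa [Matrix.updateRow_ne h] using hF k l

theorem SmoothOn.pdM (hU : IsOpen U) (hF : SmoothOn F U) (a : Fin 4) : SmoothOn (pdM a F) U :=
  fun i j => contDiffOn_pd hU (hF i j)

theorem pdM_congr (hU : IsOpen U) (h : ∀ z ∈ U, F z = H z) {y : Coord} (hy : y ∈ U) (a : Fin 4) :
    pdM a F y = pdM a H y := by
  ext i j
  exact pd_congr_of_isOpen hU (fun z hz => by rw [h z hz]) hy

theorem pdM_const (a : Fin 4) (A : Mat) (y : Coord) : pdM a (fun _ => A) y = 0 := by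
  ext i j
  exact pd_const _ _ _

theorem pdM_transpose (a : Fin 4) (y : Coord) : pdM a (fun z => (F z)ᵀ) y = (pdM a F y)ᵀ := rfl

theorem pdM_add (hU : IsOpen U) (hF : SmoothOn F U) (hH : SmoothOn H U) {y : Coord} (hy : y ∈ U)
    (a : Fin 4) : pdM a (fun z => F z + H z) y = pdM a F y + pdM a H y := by
  ext i j
  exact pd_add (hF.differentiableAt hU hy i j) (hH.differentiableAt hU hy i j)

theorem pdM_mul (hU : IsOpen U) (hF : SmoothOn F U) (hH : SmoothOn H U) {y : Coord} (hy : y ∈ U)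
    (a : Fin 4) : pdM a (fun z => F z * H z) y = pdM a F y * H y + F y * pdM a H y := by
  ext i j
  simp only [pdM_apply, Matrix.add_apply, Matrix.mul_apply]
  rw [pd_sum (f := fun k z => F z i k * H z k j) fun k _ =>
      (hF.differentiableAt hU hy i k).mul (hH.differentiableAt hU hy k j),
    ← Finset.sum_add_distrib]
  exact Finset.sum_congr rfl fun k _ =>
    pd_mul (hF.differentiableAt hU hy i k) (hH.differentiableAt hU hy k j)

theorem pdM_smul (hU : IsOpen U) {f : Coord → ℝ} (hf : ContDiffOn ℝ ∞ f U) (hH : SmoothOn H U)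
    {y : Coord} (hy : y ∈ U) (a : Fin 4) :
    pdM a (fun z => f z • H z) y = pd a f y • H y + f y • pdM a H y := by
  ext i j
  exact pd_mul (differentiableAt_of_contDiffOn hU hf hy) (hH.differentiableAt hU hy i j)

theorem pdM_comm (hU : IsOpen U) (hF : SmoothOn F U) {y : Coord} (hy : y ∈ U) (a b : Fin 4) :
    pdM a (pdM b F) y = pdM b (pdM a F) y := by
  ext i j
  exact pd_comm hU (hF i j) hy

end

/-! ### The Levi-Civita connection and its curvature in matrix form -/

/-- The connection matrix `(Γ_b)^a_c`. -/
def gammaM (G : Coord → Mat) (b : Fin 4) (y : Coord) : Mat :=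
  Matrix.of fun a c => christoffel G a b c y

/-- The curvature matrix `(R_{cd})^a_b`. -/
def riemM (G : Coord → Mat) (c d : Fin 4) (y : Coord) : Mat :=
  Matrix.of fun a b => riemannUp G a b c d y

/-- The Ricci tensor as a matrix. -/
def ricM (G : Coord → Mat) (y : Coord) : Mat := Matrix.of fun a b => ricci G a b y

/-- The Ricci endomorphism as a matrix. -/
def mixM (G : Coord → Mat) (y : Coord) : Mat := Matrix.of fun a b => ricciMixed G a b y

/-- The covariant derivative of a field of bilinear forms. -/
def nablaForm (G : Coord → Mat) (T : Coord → Mat) (a : Fin 4) (y : Coord) : Mat :=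
  pdM a T y - (gammaM G a y)ᵀ * T y - T y * gammaM G a y

/-- The covariant derivative of a field of endomorphisms. -/
def nablaEnd (G : Coord → Mat) (A : Coord → Mat) (a : Fin 4) (y : Coord) : Mat :=
  pdM a A y + gammaM G a y * A y - A y * gammaM G a y

theorem mixM_eq (G : Coord → Mat) (y : Coord) : mixM G y = (G y)⁻¹ * ricM G y := rfl

theorem covD2_eq_nablaForm (G : Coord → Mat) (T : Fin 4 → Fin 4 → Coord → ℝ) (a b c : Fin 4)
    (y : Coord) :
    covD2 G T a b c y = nablaForm G (fun z => Matrix.of fun i j => T i j z) a y b c := by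
  simp only [covD2, nablaForm, Matrix.sub_apply, Matrix.mul_apply, Matrix.transpose_apply, pdM,
    gammaM, Matrix.of_apply]
  congr 1
  exact Finset.sum_congr rfl fun d _ => mul_comm _ _

theorem riemM_eq (G : Coord → Mat) (c d : Fin 4) (y : Coord) :
    riemM G c d y = pdM c (gammaM G d) y - pdM d (gammaM G c) y
      + (gammaM G c y * gammaM G d y - gammaM G d y * gammaM G c y) := by
  ext a b
  simp only [riemM, riemannUp, Matrix.add_apply, Matrix.sub_apply, Matrix.mul_apply, pdM,
    gammaM, Matrix.of_apply, Finset.sum_sub_distrib]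

theorem riemM_antisymm (G : Coord → Mat) (c d : Fin 4) (y : Coord) :
    riemM G c d y = -riemM G d c y := by
  rw [riemM_eq, riemM_eq]; abel

/-- The metric is smooth, symmetric and nondegenerate on the open set `U`. -/
structure IsMetricOn (G : Coord → Mat) (U : Set Coord) : Prop where
  isOpen : IsOpen U
  smooth : SmoothOn G U
  symm : ∀ y ∈ U, (G y)ᵀ = G y
  det_ne : ∀ y ∈ U, (G y).det ≠ 0

namespace IsMetricOn

variable {G : Coord → Mat} {U : Set Coord}

theorem mono (h : IsMetricOn G U) {V : Set Coord} (hV : IsOpen V) (hVU : V ⊆ U) : IsMetricOn G V :=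
  ⟨hV, h.smooth.mono hVU, fun y hy => h.symm y (hVU hy), fun y hy => h.det_ne y (hVU hy)⟩

theorem mul_inv (h : IsMetricOn G U) {y : Coord} (hy : y ∈ U) : G y * (G y)⁻¹ = 1 :=
  Matrix.mul_nonsing_inv _ (isUnit_iff_ne_zero.2 (h.det_ne y hy))

theorem inv_mul (h : IsMetricOn G U) {y : Coord} (hy : y ∈ U) : (G y)⁻¹ * G y = 1 :=
  Matrix.nonsing_inv_mul _ (isUnit_iff_ne_zero.2 (h.det_ne y hy))

theorem pd_symm (h : IsMetricOn G U) {y : Coord} (hy : y ∈ U) (a b c : Fin 4) :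
    pd a (fun z => G z b c) y = pd a (fun z => G z c b) y :=
  pd_congr_of_isOpen h.isOpen (fun z hz => by
    conv_lhs => rw [← h.symm z hz]
    rfl) hy

theorem christoffel_symm (h : IsMetricOn G U) {y : Coord} (hy : y ∈ U) (a b c : Fin 4) :
    christoffel G a b c y = christoffel G a c b y := by
  simp only [christoffel]
  congr 1
  refine Finset.sum_congr rfl fun d _ => ?_
  rw [h.pd_symm hy d b c]; ring

theorem smooth_inv (h : IsMetricOn G U) : SmoothOn (fun z => (G z)⁻¹) U := h.smooth.inv h.det_ne

theorem smooth_gammaM (h : IsMetricOn G U) (b : Fin 4) : SmoothOn (gammaM G b) U := fun a c => by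
  simp only [gammaM, Matrix.of_apply, christoffel]
  refine contDiffOn_const.mul (ContDiffOn.sum fun d _ => (h.smooth_inv a d).mul ?_)
  exact ((contDiffOn_pd h.isOpen (h.smooth c d)).add (contDiffOn_pd h.isOpen (h.smooth b d))).sub
    (contDiffOn_pd h.isOpen (h.smooth b c))

theorem smooth_riemM (h : IsMetricOn G U) (c d : Fin 4) : SmoothOn (riemM G c d) U := by
  have : riemM G c d = fun y => pdM c (gammaM G d) y - pdM d (gammaM G c) y
      + (gammaM G c y * gammaM G d y - gammaM G d y * gammaM G c y) :=
    funext fun y => riemM_eq G c d y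
  rw [this]
  exact (((h.smooth_gammaM d).pdM h.isOpen c).sub ((h.smooth_gammaM c).pdM h.isOpen d)).add
    (((h.smooth_gammaM c).mul (h.smooth_gammaM d)).sub
      ((h.smooth_gammaM d).mul (h.smooth_gammaM c)))

theorem smooth_ricM (h : IsMetricOn G U) : SmoothOn (ricM G) U := fun a b => by
  simp only [ricM, Matrix.of_apply, ricci]
  exact ContDiffOn.sum fun c _ => h.smooth_riemM c b c a

theorem smooth_mixM (h : IsMetricOn G U) : SmoothOn (mixM G) U := h.smooth_inv.mul h.smooth_ricM

theorem mul_mixM (h : IsMetricOn G U) {y : Coord} (hy : y ∈ U) : G y * mixM G y = ricM G y := by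
  rw [mixM_eq, ← Matrix.mul_assoc, h.mul_inv hy, Matrix.one_mul]

theorem metric_mul_gammaM (h : IsMetricOn G U) {y : Coord} (hy : y ∈ U) (a b c : Fin 4) :
    (G y * gammaM G b y) a c = (1 / 2) * (pd b (fun z => G z c a) y + pd c (fun z => G z b a) y
      - pd a (fun z => G z b c) y) := by
  have e : gammaM G b y = (G y)⁻¹ * Matrix.of fun d c => (1 / 2) * (pd b (fun z => G z c d) y
      + pd c (fun z => G z b d) y - pd d (fun z => G z b c) y) := by
    ext i j
    simp only [gammaM, christoffel, Matrix.of_apply, Matrix.mul_apply, ginv, Finset.mul_sum]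
    exact Finset.sum_congr rfl fun _ _ => by ring
  rw [e, ← Matrix.mul_assoc, h.mul_inv hy, Matrix.one_mul]
  rfl

/-- Metric compatibility of the Levi-Civita connection. -/
theorem nablaForm_metric (h : IsMetricOn G U) {y : Coord} (hy : y ∈ U) (a : Fin 4) : nablaForm G G a y = 0 := by
  have e : (gammaM G a y)ᵀ * G y = (G y * gammaM G a y)ᵀ := by
    rw [Matrix.transpose_mul, h.symm y hy]
  ext b c
  simp only [nablaForm, e, Matrix.sub_apply, Matrix.transpose_apply, h.metric_mul_gammaM hy,
    pdM_apply, Matrix.zero_apply]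
  rw [h.pd_symm hy a c b, h.pd_symm hy b a c, h.pd_symm hy c a b]
  ring

theorem pdM_metric (h : IsMetricOn G U) {y : Coord} (hy : y ∈ U) (a : Fin 4) :
    pdM a G y = (gammaM G a y)ᵀ * G y + G y * gammaM G a y := by
  have := h.nablaForm_metric hy a
  rw [nablaForm, sub_sub, sub_eq_zero] at this
  exact this

/-- A consequence of ∇g = 0. It moves computations from forms to endomorphisms, where the Leibniz
rule is that of matrix multiplication. -/
theorem nablaForm_lower (h : IsMetricOn G U) {A : Coord → Mat} (hA : SmoothOn A U) {y : Coord} (hy : y ∈ U)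
    (a : Fin 4) : nablaForm G (fun z => G z * A z) a y = G y * nablaEnd G A a y := by
  rw [nablaForm, nablaEnd, pdM_mul h.isOpen h.smooth hA hy, h.pdM_metric hy]
  noncomm_ring

theorem nablaForm_ricM (h : IsMetricOn G U) {y : Coord} (hy : y ∈ U) (a : Fin 4) :
    nablaForm G (ricM G) a y = G y * nablaEnd G (mixM G) a y := by
  rw [← h.nablaForm_lower h.smooth_mixM hy]
  simp only [nablaForm, h.mul_mixM hy]
  rw [pdM_congr h.isOpen (fun z hz => (h.mul_mixM hz).symm) hy]

theorem nablaEnd_mul (h : IsMetricOn G U) {A B : Coord → Mat} (hA : SmoothOn A U) (hB : SmoothOn B U) {y : Coord}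
    (hy : y ∈ U) (a : Fin 4) :
    nablaEnd G (fun z => A z * B z) a y = nablaEnd G A a y * B y + A y * nablaEnd G B a y := by
  simp only [nablaEnd, pdM_mul h.isOpen hA hB hy]
  noncomm_ring

theorem nablaEnd_congr (h : IsMetricOn G U) {A B : Coord → Mat} (hAB : ∀ z ∈ U, A z = B z) {y : Coord}
    (hy : y ∈ U) (a : Fin 4) : nablaEnd G A a y = nablaEnd G B a y := by
  simp only [nablaEnd, pdM_congr h.isOpen hAB hy, hAB y hy]

/-- The Ricci identity for a parallel bilinear form. -/
theorem riemM_of_parallel (h : IsMetricOn G U) {T : Coord → Mat} (hT : SmoothOn T U)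
    (hpar : ∀ z ∈ U, ∀ a, nablaForm G T a z = 0) {y : Coord} (hy : y ∈ U) (c d : Fin 4) :
    (riemM G c d y)ᵀ * T y + T y * riemM G c d y = 0 := by
  -- Parallelism is a linear first-order system for `T`. Its integrability condition, the equality
  -- of mixed second partials, is the claim.
  have hp : ∀ z ∈ U, ∀ a, pdM a T z = (gammaM G a z)ᵀ * T z + T z * gammaM G a z := by
    intro z hz a
    have := hpar z hz a
    rw [nablaForm, sub_sub, sub_eq_zero] at this
    exact this
  have hpp : ∀ a b, pdM a (pdM b T) y = (pdM a (gammaM G b) y)ᵀ * T y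
      + (gammaM G b y)ᵀ * pdM a T y + (pdM a T y * gammaM G b y + T y * pdM a (gammaM G b) y) := by
    intro a b
    rw [pdM_congr h.isOpen (fun z hz => hp z hz b) hy,
      pdM_add h.isOpen ((h.smooth_gammaM b).transpose.mul hT) (hT.mul (h.smooth_gammaM b)) hy,
      pdM_mul h.isOpen (h.smooth_gammaM b).transpose hT hy,
      pdM_mul h.isOpen hT (h.smooth_gammaM b) hy, pdM_transpose]
  have hc := pdM_comm h.isOpen hT hy c d
  rw [hpp, hpp, hp y hy, hp y hy, ← sub_eq_zero] at hc
  rw [riemM_eq, ← hc]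
  simp only [Matrix.transpose_add, Matrix.transpose_sub, Matrix.transpose_mul]
  noncomm_ring

theorem riemM_metric_skew (h : IsMetricOn G U) {y : Coord} (hy : y ∈ U) (c d : Fin 4) :
    (riemM G c d y)ᵀ * G y + G y * riemM G c d y = 0 :=
  h.riemM_of_parallel h.smooth (fun _ hz a => h.nablaForm_metric hz a) hy c d

/-- The first Bianchi identity. -/
theorem bianchi (h : IsMetricOn G U) {y : Coord} (hy : y ∈ U) (a b c d : Fin 4) :
    riemM G c d y a b + riemM G d b y a c + riemM G b c y a d = 0 := by
  -- Vanishing torsion makes the derivative terms and the quadratic terms cancel separately in the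
  -- cyclic sum.
  have hp : ∀ i j k l, pd i (christoffel G j k l) y = pd i (christoffel G j l k) y :=
    fun i j k l => pd_congr_of_isOpen h.isOpen (fun z hz => h.christoffel_symm hz j k l) hy
  simp only [riemM, riemannUp, Matrix.of_apply]
  rw [hp c a d b, hp d a c b, hp b a d c]
  have hs : ∀ i j k, christoffel G i j k y = christoffel G i k j y := h.christoffel_symm hy
  simp only [Finset.sum_sub_distrib]
  simp only [hs _ d b, hs _ c b, hs _ d c]
  ring

end IsMetricOn

/-! ### Pseudo-orthonormal frames and the Segré normal form -/

theorem eta_mul_eta : eta * eta = 1 := by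
  rw [eta, Matrix.diagonal_mul_diagonal, ← Matrix.diagonal_one]
  congr 1
  ext i
  fin_cases i <;> norm_num

theorem eta_transpose : etaᵀ = eta := Matrix.diagonal_transpose _

/-- The Segré normal form of a trace-free Ricci endomorphism. -/
def segreDiag (ρ : ℝ) : Mat := Matrix.diagonal ![ρ, ρ, -ρ, -ρ]

theorem segreDiag_mul_self (ρ : ℝ) : segreDiag ρ * segreDiag ρ = (ρ ^ 2) • 1 := by
  rw [segreDiag, Matrix.diagonal_mul_diagonal, Matrix.smul_one_eq_diagonal]
  congr 1
  ext i
  fin_cases i <;> simp <;> ring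

/-- The columns of `E` form a pseudo-orthonormal basis for `g`. -/
def IsFrame (g E : Mat) : Prop := Eᵀ * g * E = eta

namespace IsFrame

variable {g E : Mat}

/-- Shows that both `E` and `g` are nondegenerate, without assuming either. -/
theorem left_inv (h : IsFrame g E) : (eta * Eᵀ * g) * E = 1 := by
  rw [← eta_mul_eta, ← show Eᵀ * g * E = eta from h]
  simp only [Matrix.mul_assoc]

theorem isUnit_det (h : IsFrame g E) : IsUnit E.det := by
  rw [isUnit_iff_ne_zero]
  intro h0
  have := congrArg Matrix.det h.left_inv
  simp [Matrix.det_mul, h0] at this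

theorem metric_det_ne (h : IsFrame g E) : g.det ≠ 0 := by
  intro h0
  have := congrArg Matrix.det h.left_inv
  simp [Matrix.det_mul, h0] at this

theorem mul_inv (h : IsFrame g E) : E * E⁻¹ = 1 := Matrix.mul_nonsing_inv _ h.isUnit_det

theorem inv_mul (h : IsFrame g E) : E⁻¹ * E = 1 := Matrix.nonsing_inv_mul _ h.isUnit_det

theorem cancel_right (h : IsFrame g E) {A B : Mat} (hAB : A * E = B * E) : A = B := by
  have := congrArg (· * E⁻¹) hAB
  simpa only [Matrix.mul_assoc, h.mul_inv, Matrix.mul_one] using this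

theorem cancel_left_transpose (h : IsFrame g E) {A B : Mat} (hAB : Eᵀ * A = Eᵀ * B) : A = B := by
  have := congrArg Matrix.transpose hAB
  simp only [Matrix.transpose_mul, Matrix.transpose_transpose] at this
  exact Matrix.transpose_injective (h.cancel_right this)

theorem cancel (h : IsFrame g E) {A B : Mat} (hAB : Eᵀ * A * E = Eᵀ * B * E) : A = B :=
  h.cancel_left_transpose (h.cancel_right hAB)

/-- The completeness relation of the frame; it turns contractions with the inverse metric into
signed sums over frame indices. -/
theorem inv_metric (h : IsFrame g E) : g⁻¹ = E * eta * Eᵀ := by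
  refine Matrix.inv_eq_right_inv ?_
  refine h.cancel_left_transpose ?_
  rw [show Eᵀ * (g * (E * eta * Eᵀ)) = (Eᵀ * g * E) * eta * Eᵀ by simp only [Matrix.mul_assoc],
    show Eᵀ * g * E = eta from h, eta_mul_eta, Matrix.one_mul, Matrix.mul_one]

theorem eq_zero_of_contract (h : IsFrame g E) {w : Fin 4 → ℝ} (hw : ∀ i, ∑ a, E a i * w a = 0)
    (a : Fin 4) : w a = 0 := by
  have hv : Eᵀ *ᵥ w = 0 := funext fun i => hw i
  have hu : IsUnit (Eᵀ).det := by rw [Matrix.det_transpose]; exact h.isUnit_det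
  have := congrArg ((Eᵀ)⁻¹ *ᵥ ·) hv
  simp only [Matrix.mulVec_mulVec, Matrix.nonsing_inv_mul _ hu, Matrix.one_mulVec,
    Matrix.mulVec_zero] at this
  exact congrFun this a

end IsFrame

/-- The frame `E` brings the trace-free Ricci endomorphism `S` to Segré normal form. -/
structure IsSegreFrame (g S E : Mat) (ρ : ℝ) : Prop where
  frame : IsFrame g E
  eigen : S * E = E * segreDiag ρ
  ne_zero : ρ ≠ 0

namespace IsSegreFrame

variable {g S E : Mat} {ρ : ℝ}

theorem sq (h : IsSegreFrame g S E ρ) : S * S = (ρ ^ 2) • 1 := by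
  refine h.frame.cancel_right ?_
  rw [Matrix.mul_assoc, h.eigen, ← Matrix.mul_assoc, h.eigen, Matrix.mul_assoc,
    segreDiag_mul_self]
  simp

theorem form (h : IsSegreFrame g S E ρ) : Eᵀ * (g * S) * E = eta * segreDiag ρ := by
  rw [Matrix.mul_assoc, Matrix.mul_assoc, h.eigen, ← Matrix.mul_assoc g, ← Matrix.mul_assoc,
    ← Matrix.mul_assoc, show Eᵀ * g * E = eta from h.frame]

end IsSegreFrame

/-- A trace-free Segré type `{(1,1)(11)}` puts the Ricci endomorphism in normal form. -/
theorem exists_isSegreFrame {G : Coord → Mat} {y : Coord} (hs : SegreAt G y)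
    (h0 : scalarCurv G y = 0) :
    (ricM G y)ᵀ = ricM G y ∧ ∃ E ρ, IsSegreFrame (G y) (mixM G y) E ρ := by
  obtain ⟨v, ρ, σ, hne, horth, heig⟩ := hs
  set E : Mat := Matrix.of fun a i => v i a with hE
  have hfr : IsFrame (G y) E := by
    ext i j
    rw [← horth i j]
    simp only [Matrix.mul_apply, Matrix.transpose_apply, hE, Matrix.of_apply, Finset.sum_mul]
    rw [Finset.sum_comm]
    exact Finset.sum_congr rfl fun a _ => Finset.sum_congr rfl fun b _ => by ring
  have hei : mixM G y * E = E * Matrix.diagonal ![ρ, ρ, σ, σ] := by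
    ext a i
    rw [Matrix.mul_diagonal]
    simp only [Matrix.mul_apply, hE, Matrix.of_apply, mixM]
    rw [heig i a]; ring
  have hGS : G y * mixM G y = ricM G y := by
    rw [mixM_eq, ← Matrix.mul_assoc,
      Matrix.mul_nonsing_inv _ (isUnit_iff_ne_zero.2 hfr.metric_det_ne), Matrix.one_mul]
  have hform : Eᵀ * ricM G y * E = eta * Matrix.diagonal ![ρ, ρ, σ, σ] := by
    rw [← hGS, Matrix.mul_assoc, Matrix.mul_assoc, hei, ← Matrix.mul_assoc (G y),
      ← Matrix.mul_assoc, ← Matrix.mul_assoc, show Eᵀ * G y * E = eta from hfr]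
  -- The Ricci tensor is symmetric because it is diagonal in the frame; the curvature identities are
  -- not used.
  have hsy : (ricM G y)ᵀ = ricM G y := by
    refine hfr.cancel ?_
    have := congrArg Matrix.transpose hform
    simp only [Matrix.transpose_mul, Matrix.transpose_transpose, eta, Matrix.diagonal_transpose]
      at this
    rw [Matrix.mul_assoc, this, hform, eta, Matrix.diagonal_mul_diagonal,
      Matrix.diagonal_mul_diagonal]
    congr 1; ext i; ring
  refine ⟨hsy, E, ρ, ?_⟩
  -- The trace of S is R by the symmetry just shown; computed in the frame it is 2ρ + 2σ, whence σ =
  -- -ρ.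
  have htr : (mixM G y).trace = 0 := by
    rw [← h0]
    simp only [Matrix.trace, Matrix.diag, mixM, Matrix.of_apply, ricciMixed, scalarCurv]
    refine Finset.sum_congr rfl fun a _ => Finset.sum_congr rfl fun b _ => ?_
    rw [show ricci G b a y = ricci G a b y from congrFun (congrFun hsy a) b]
  have htr' : (mixM G y).trace = 2 * ρ + 2 * σ := by
    have : mixM G y = E * Matrix.diagonal ![ρ, ρ, σ, σ] * E⁻¹ := by
      rw [← hei, Matrix.mul_assoc, hfr.mul_inv, Matrix.mul_one]
    rw [this, Matrix.trace_mul_comm, ← Matrix.mul_assoc, hfr.inv_mul, Matrix.one_mul,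
      Matrix.trace_diagonal]
    simp [Fin.sum_univ_four]; ring
  have hσ : σ = -ρ := by linarith
  subst hσ
  exact ⟨hfr, hei, fun h => hne (by rw [h]; simp)⟩

/-! ### Algebra of Codazzi tensors -/

/-- Pigeonhole: two of the three indices lie in {0,1} or in {2,3}. By symmetry they may be moved to
the last two places, where the hypotheses apply. -/
theorem eq_zero_of_symmetric {T : Fin 4 → Fin 4 → Fin 4 → ℝ} (hs12 : ∀ i j k, T i j k = T j i k)
    (hs23 : ∀ i j k, T i j k = T i k j) (hd : ∀ i j, T i j j = 0) (e01 : ∀ i, T i 0 1 = 0)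
    (e23 : ∀ i, T i 2 3 = 0) (i j k : Fin 4) : T i j k = 0 := by
  have hd' : ∀ i j, T j i j = 0 := fun i j => by rw [hs12, hd]
  have hd'' : ∀ i j, T j j i = 0 := fun i j => by rw [hs23, hd']
  have a1 : ∀ i, T i 1 0 = 0 := fun i => by rw [hs23, e01]
  have a2 : ∀ i, T i 3 2 = 0 := fun i => by rw [hs23, e23]
  have b1 : ∀ i, T 0 i 1 = 0 := fun i => by rw [hs12, e01]
  have b2 : ∀ i, T 1 i 0 = 0 := fun i => by rw [hs12, a1]
  have b3 : ∀ i, T 2 i 3 = 0 := fun i => by rw [hs12, e23]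
  have b4 : ∀ i, T 3 i 2 = 0 := fun i => by rw [hs12, a2]
  have c1 : ∀ i, T 0 1 i = 0 := fun i => by rw [hs23, b1]
  have c2 : ∀ i, T 1 0 i = 0 := fun i => by rw [hs23, b2]
  have c3 : ∀ i, T 2 3 i = 0 := fun i => by rw [hs23, b3]
  have c4 : ∀ i, T 3 2 i = 0 := fun i => by rw [hs23, b4]
  fin_cases i <;> fin_cases j <;> fin_cases k <;>
    first
      | exact hd _ _ | exact hd' _ _ | exact hd'' _ _ | exact e01 _ | exact e23 _ | exact a1 _
      | exact a2 _ | exact b1 _ | exact b2 _ | exact b3 _ | exact b4 _ | exact c1 _ | exact c2 _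
      | exact c3 _ | exact c4 _

/-- A Codazzi tensor of Segré type `{(1,1)(11)}` with opposite eigenvalues is parallel: the
algebraic part of the argument. -/
theorem codazzi_eq_zero {g S E : Mat} {ρ : ℝ} (h : IsSegreFrame g S E ρ) {N : Fin 4 → Mat}
    {l : Fin 4 → ℝ} (h12 : ∀ a b c, N a b c = N b a c) (h23 : ∀ a, (N a)ᵀ = N a)
    (hN : ∀ a, N a * S + Sᵀ * N a = l a • g) : (∀ a, N a = 0) ∧ ∀ a, l a = 0 := by
  let T : Fin 4 → Fin 4 → Fin 4 → ℝ := fun i j k => ∑ a, E a i * (Eᵀ * N a * E) j k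
  let K : Fin 4 → ℝ := fun i => ∑ a, E a i * l a
  have hs23 : ∀ i j k, T i j k = T i k j := by
    intro i j k
    refine Finset.sum_congr rfl fun a _ => ?_
    have : (Eᵀ * N a * E)ᵀ = Eᵀ * N a * E := by
      simp only [Matrix.transpose_mul, Matrix.transpose_transpose, h23, Matrix.mul_assoc]
    conv_lhs => rw [← this]
    rfl
  have hs12 : ∀ i j k, T i j k = T j i k := by
    intro i j k
    have e : ∀ i j k, T i j k = ∑ c, E c k * ∑ a, ∑ b, E a i * E b j * N a b c := by
      intro i j k
      simp only [T, Matrix.mul_apply, Matrix.transpose_apply, Finset.mul_sum, Finset.sum_mul]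
      rw [Finset.sum_comm]
      exact Finset.sum_congr rfl fun c _ => Finset.sum_congr rfl fun a _ =>
        Finset.sum_congr rfl fun b _ => by ring
    rw [e, e]
    refine Finset.sum_congr rfl fun c _ => ?_
    rw [Finset.sum_comm]
    congr 1
    exact Finset.sum_congr rfl fun b _ => Finset.sum_congr rfl fun a _ => by rw [h12 a b c]; ring
  -- The relation `hN` in the eigenframe, where S is diagonal and g is `eta`.
  have hrel : ∀ i j k, T i j k * (![ρ, ρ, -ρ, -ρ] j + ![ρ, ρ, -ρ, -ρ] k) = K i * eta j k := by
    intro i j k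
    have hm : ∀ a, (Eᵀ * N a * E) * segreDiag ρ + segreDiag ρ * (Eᵀ * N a * E) = l a • eta := by
      intro a
      have h1 : Eᵀ * Sᵀ = segreDiag ρ * Eᵀ := by
        rw [← Matrix.transpose_mul, h.eigen, Matrix.transpose_mul, segreDiag,
          Matrix.diagonal_transpose]
      rw [← show Eᵀ * g * E = eta from h.frame, ← Matrix.smul_mul, ← Matrix.mul_smul, ← hN a,
        Matrix.mul_add, Matrix.add_mul, ← Matrix.mul_assoc Eᵀ Sᵀ, h1, ← Matrix.mul_assoc Eᵀ (N a),
        Matrix.mul_assoc _ S E, h.eigen]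
      simp only [Matrix.mul_assoc]
    simp only [T, K, Finset.sum_mul]
    refine Finset.sum_congr rfl fun a _ => ?_
    have := congrFun (congrFun (hm a) j) k
    simp only [segreDiag, Matrix.add_apply, Matrix.mul_diagonal, Matrix.diagonal_mul,
      Matrix.smul_apply, smul_eq_mul] at this
    rw [mul_assoc (E a i) (l a), ← this]
    ring
  have hρ := h.ne_zero
  have e01 : ∀ i, T i 0 1 = 0 := fun i => by
    have := hrel i 0 1
    simp [eta] at this
    rcases this with h | h
    · exact h
    · exact absurd (by linarith) hρ
  have e23 : ∀ i, T i 2 3 = 0 := fun i => by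
    have := hrel i 2 3
    simp [eta] at this
    rcases this with h | h
    · exact h
    · exact absurd (by linarith) hρ
  have r0 : ∀ i, T i 0 0 * (ρ + ρ) = -K i := fun i => by simpa [eta] using hrel i 0 0
  have r1 : ∀ i, T i 1 1 * (ρ + ρ) = K i := fun i => by simpa [eta] using hrel i 1 1
  have r2 : ∀ i, T i 2 2 * (-ρ + -ρ) = K i := fun i => by simpa [eta] using hrel i 2 2
  have r3 : ∀ i, T i 3 3 * (-ρ + -ρ) = K i := fun i => by simpa [eta] using hrel i 3 3
  -- For each i let j be the other index of its block. Then `K i` is a multiple of T_ijj, which by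
  -- symmetry is an off-diagonal component T_jij of that block and so vanishes.
  have hK : ∀ i, K i = 0 := by
    intro i
    fin_cases i
    · show K 0 = 0
      rw [← r1 0, hs12 0 1 1, e01, zero_mul]
    · show K 1 = 0
      rw [← neg_eq_zero, ← r0 1, hs12 1 0 0, hs23 0 1 0, e01, zero_mul]
    · show K 2 = 0
      rw [← r3 2, hs12 2 3 3, e23, zero_mul]
    · show K 3 = 0
      rw [← r2 3, hs12 3 2 2, hs23 2 3 2, e23, zero_mul]
  have hd : ∀ i j, T i j j = 0 := by
    intro i j
    have h2 : ρ + ρ ≠ 0 := fun h => hρ (by linarith)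
    have h3 : -ρ + -ρ ≠ 0 := fun h => hρ (by linarith)
    fin_cases j
    · exact (mul_eq_zero.1 ((r0 i).trans (by simp [hK]))).resolve_right h2
    · exact (mul_eq_zero.1 ((r1 i).trans (hK i))).resolve_right h2
    · exact (mul_eq_zero.1 ((r2 i).trans (hK i))).resolve_right h3
    · exact (mul_eq_zero.1 ((r3 i).trans (hK i))).resolve_right h3
  have hT : ∀ i j k, T i j k = 0 := eq_zero_of_symmetric hs12 hs23 hd e01 e23
  constructor
  · intro a
    refine h.frame.cancel ?_
    ext j k
    rw [h.frame.eq_zero_of_contract (w := fun a => (Eᵀ * N a * E) j k) (fun i => hT i j k) a]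
    simp
  · exact h.frame.eq_zero_of_contract hK

/-! ### Four-index tensors in a frame and the shape of the curvature -/

/-- A tensor with four indices. -/
abbrev Tensor4 := Fin 4 → Fin 4 → Fin 4 → Fin 4 → ℝ

/-- The components of a four times covariant tensor in the frame `E`. -/
def frameComp (E : Mat) (W : Tensor4) : Tensor4 := fun i j k l =>
  ∑ a, ∑ b, ∑ c, ∑ d, E a i * E b j * E c k * E d l * W a b c d

section

variable (E : Mat) (W W' : Tensor4)

theorem frameComp_add (i j k l : Fin 4) : frameComp E (fun a b c d => W a b c d + W' a b c d) i j k l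
    = frameComp E W i j k l + frameComp E W' i j k l := by
  simp only [frameComp, mul_add, Finset.sum_add_distrib]

theorem frameComp_sub (i j k l : Fin 4) : frameComp E (fun a b c d => W a b c d - W' a b c d) i j k l
    = frameComp E W i j k l - frameComp E W' i j k l := by
  simp only [frameComp, mul_sub, Finset.sum_sub_distrib]

theorem frameComp_smul (r : ℝ) (i j k l : Fin 4) :
    frameComp E (fun a b c d => r * W a b c d) i j k l = r * frameComp E W i j k l := by
  simp only [frameComp, Finset.mul_sum]
  exact Finset.sum_congr rfl fun a _ => Finset.sum_congr rfl fun b _ =>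
    Finset.sum_congr rfl fun c _ => Finset.sum_congr rfl fun d _ => by ring

theorem frameComp_swap_left (i j k l : Fin 4) :
    frameComp E (fun a b c d => W b a c d) i j k l = frameComp E W j i k l := by
  simp only [frameComp]
  rw [Finset.sum_comm]
  exact Finset.sum_congr rfl fun a _ => Finset.sum_congr rfl fun b _ =>
    Finset.sum_congr rfl fun c _ => Finset.sum_congr rfl fun d _ => by ring

theorem frameComp_swap_right (i j k l : Fin 4) :
    frameComp E (fun a b c d => W a b d c) i j k l = frameComp E W i j l k := by
  simp only [frameComp]
  refine Finset.sum_congr rfl fun a _ => Finset.sum_congr rfl fun b _ => ?_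
  rw [Finset.sum_comm]
  exact Finset.sum_congr rfl fun c _ => Finset.sum_congr rfl fun d _ => by ring

theorem frameComp_swap_mid (i j k l : Fin 4) :
    frameComp E (fun a b c d => W a c b d) i j k l = frameComp E W i k j l := by
  simp only [frameComp]
  refine Finset.sum_congr rfl fun a _ => ?_
  rw [Finset.sum_comm]
  exact Finset.sum_congr rfl fun b _ => Finset.sum_congr rfl fun c _ =>
    Finset.sum_congr rfl fun d _ => by ring

theorem transpose_mul_mul_apply (A : Mat) (i j : Fin 4) :
    (Eᵀ * A * E) i j = ∑ a, ∑ b, E a i * E b j * A a b := by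
  simp only [Matrix.mul_apply, Matrix.transpose_apply, Finset.sum_mul]
  rw [Finset.sum_comm]
  exact Finset.sum_congr rfl fun c _ => Finset.sum_congr rfl fun d _ => by ring

theorem frameComp_prod (A B : Mat) (i j k l : Fin 4) :
    frameComp E (fun a b c d => A a b * B c d) i j k l
      = (Eᵀ * A * E) i j * (Eᵀ * B * E) k l := by
  rw [transpose_mul_mul_apply, transpose_mul_mul_apply]
  simp only [frameComp, Finset.sum_mul]
  simp only [Finset.mul_sum]
  exact Finset.sum_congr rfl fun a _ => Finset.sum_congr rfl fun b _ =>
    Finset.sum_congr rfl fun c _ => Finset.sum_congr rfl fun d _ => by ring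

theorem frameComp_eq_matrix (Q : Fin 4 → Fin 4 → Mat) (i j k l : Fin 4) :
    frameComp E (fun a b c d => Q c d a b) i j k l
      = ∑ c, ∑ d, E c k * E d l * (Eᵀ * Q c d * E) i j := by
  simp only [transpose_mul_mul_apply, frameComp, Finset.mul_sum]
  rw [Finset.sum_congr rfl fun a _ => Finset.sum_comm, Finset.sum_comm]
  refine Finset.sum_congr rfl fun c _ => ?_
  rw [Finset.sum_congr rfl fun a _ => Finset.sum_comm, Finset.sum_comm]
  exact Finset.sum_congr rfl fun d _ => Finset.sum_congr rfl fun a _ =>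
    Finset.sum_congr rfl fun b _ => by ring

variable {E W}

/-- The invertibility of the frame matrix is applied to one index at a time. -/
theorem eq_zero_of_frameComp {g : Mat} (hE : IsFrame g E) (hW : ∀ i j k l, frameComp E W i j k l = 0)
    (a b c d : Fin 4) : W a b c d = 0 := by
  have h1 : ∀ i j k l, ∑ a, E a i * (∑ b, E b j * (∑ c, E c k * (∑ d, E d l * W a b c d))) = 0 := by
    intro i j k l
    rw [← hW i j k l]
    simp only [frameComp, Finset.mul_sum, mul_assoc]
  have h2 := fun j k l => hE.eq_zero_of_contract (fun i => h1 i j k l)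
  have h3 := fun a k l => hE.eq_zero_of_contract (fun j => h2 j k l a)
  have h4 := fun a b l => hE.eq_zero_of_contract (fun k => h3 a k l b)
  exact hE.eq_zero_of_contract (fun l => h4 a b l c) d

end

/-- A tensor with the symmetries of the Riemann tensor that commutes with the projections onto the
two blocks is determined by its Ricci contractions. -/
theorem curvature_of_blocks {Z : Tensor4} {ρ : ℝ} (hρ : ρ ≠ 0)
    (h12 : ∀ i j k l, Z i j k l = -Z j i k l) (h34 : ∀ i j k l, Z i j k l = -Z i j l k)
    (hB : ∀ i j k l, Z i j k l + Z i k l j + Z i l j k = 0)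
    (hS : ∀ i j k l, ![ρ, ρ, -ρ, -ρ] i * Z i j k l = Z i j k l * ![ρ, ρ, -ρ, -ρ] j)
    (hR : ∀ j l, ∑ i, eta i i * Z i j i l = (eta * segreDiag ρ) j l) (i j k l : Fin 4) :
    Z i j k l = (1 / 2) * (eta i k * (eta * segreDiag ρ) j l - eta i l * (eta * segreDiag ρ) j k
      - eta j k * (eta * segreDiag ρ) i l + eta j l * (eta * segreDiag ρ) i k) := by
  -- The classical deduction of pair symmetry from the two antisymmetries and four instances of the
  -- Bianchi identity.
  have hp : ∀ i j k l, Z i j k l = Z k l i j := by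
    intro i j k l
    linarith [hB i j k l, hB j k l i, hB k l i j, hB l i j k, h12 i j k l, h34 i j k l,
      h12 k l i j, h34 k l i j, h12 i k l j, h34 i k l j, h12 i l j k, h34 i l j k,
      h12 j k l i, h34 j k l i, h12 j l i k, h34 j l i k, h12 j i k l, h34 j i k l,
      h12 k i j l, h34 k i j l, h12 k j l i, h34 k j l i, h12 l i j k, h34 l i j k,
      h12 l j k i, h34 l j k i, h12 l k i j, h34 l k i j, h34 j k i l, h34 l i k j]
  have z11 : ∀ i k l, Z i i k l = 0 := fun i k l => by linarith [h12 i i k l]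
  have z33 : ∀ i k l, Z k l i i = 0 := fun i k l => by linarith [h34 k l i i]
  have hmix : ∀ i j, ![ρ, ρ, -ρ, -ρ] i ≠ ![ρ, ρ, -ρ, -ρ] j → ∀ k l, Z i j k l = 0 := by
    intro i j hij k l
    have := hS i j k l
    have h' : (![ρ, ρ, -ρ, -ρ] i - ![ρ, ρ, -ρ, -ρ] j) * Z i j k l = 0 := by linarith
    exact (mul_eq_zero.1 h').resolve_left (sub_ne_zero.2 hij)
  have hne : ρ ≠ -ρ := fun h => hρ (by linarith)
  have m02 : ∀ k l, Z 0 2 k l = 0 := hmix 0 2 (by simpa using hne)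
  have m03 : ∀ k l, Z 0 3 k l = 0 := hmix 0 3 (by simpa using hne)
  have m12 : ∀ k l, Z 1 2 k l = 0 := hmix 1 2 (by simpa using hne)
  have m13 : ∀ k l, Z 1 3 k l = 0 := hmix 1 3 (by simpa using hne)
  have n02 : ∀ k l, Z k l 0 2 = 0 := fun k l => by rw [hp, m02]
  have n03 : ∀ k l, Z k l 0 3 = 0 := fun k l => by rw [hp, m03]
  have n12 : ∀ k l, Z k l 1 2 = 0 := fun k l => by rw [hp, m12]
  have n13 : ∀ k l, Z k l 1 3 = 0 := fun k l => by rw [hp, m13]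
  -- The other two terms of the Bianchi sum have a first pair meeting both blocks.
  have z0123 : Z 0 1 2 3 = 0 := by
    linarith [hB 0 1 2 3, m02 3 1, m03 1 2]
  have z2301 : Z 2 3 0 1 = 0 := by rw [hp, z0123]
  -- In the (1,1) and (3,3) Ricci contractions a single sectional component survives.
  have e1 : Z 0 1 0 1 = -ρ := by
    have := hR 1 1
    simp [Fin.sum_univ_four, eta, segreDiag, z11] at this
    linarith [h12 2 1 2 1, m12 2 1, h12 3 1 3 1, m13 3 1]
  have e2 : Z 2 3 2 3 = -ρ := by
    have := hR 3 3
    simp [Fin.sum_univ_four, eta, segreDiag, z11, m03, m13] at this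
    linarith
  have hlow : ∀ i j k l, i < j → k < l →
      Z i j k l = (1 / 2) * (eta i k * (eta * segreDiag ρ) j l - eta i l * (eta * segreDiag ρ) j k
      - eta j k * (eta * segreDiag ρ) i l + eta j l * (eta * segreDiag ρ) i k) := by
    intro i j k l hij hkl
    fin_cases i <;> fin_cases j <;> first | exact absurd hij (by decide) | skip
    all_goals fin_cases k <;> fin_cases l <;> first | exact absurd hkl (by decide) | skip
    all_goals simp [eta, segreDiag, m02, m03, m12, m13, n02, n03, n12, n13, z0123, z2301, e1, e2]
    all_goals ring
  have hcomm : ∀ i j, eta i j = eta j i := fun i j => by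
    conv_lhs => rw [← eta_transpose]
    rfl
  rcases lt_trichotomy i j with hij | rfl | hij <;> rcases lt_trichotomy k l with hkl | rfl | hkl
  · exact hlow i j k l hij hkl
  · rw [z33]; ring
  · rw [h34, hlow i j l k hij hkl]; ring
  · rw [z11]; ring
  · rw [z33]; ring
  · rw [z11]; ring
  · rw [h12, hlow j i k l hij hkl]; ring
  · rw [z33]; ring
  · rw [h12, h34, hlow j i l k hij hkl]; ring

theorem sum_reverse3 (f : Fin 4 → Fin 4 → Fin 4 → ℝ) :
    ∑ i, ∑ j, ∑ k, f i j k = ∑ k, ∑ j, ∑ i, f i j k := by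
  rw [Finset.sum_comm, Finset.sum_congr rfl fun j _ => Finset.sum_comm, Finset.sum_comm]

theorem sum_reverse4 (f : Tensor4) :
    ∑ i, ∑ j, ∑ k, ∑ l, f i j k l = ∑ l, ∑ k, ∑ j, ∑ i, f i j k l := by
  rw [Finset.sum_congr rfl fun i _ => sum_reverse3 _, Finset.sum_comm]
  refine Finset.sum_congr rfl fun l _ => ?_
  rw [Finset.sum_comm, Finset.sum_congr rfl fun k _ => Finset.sum_comm]

/-- The curvature of a metric with parallel Ricci tensor of trace-free Segré type
`{(1,1)(11)}`. -/
theorem curvature_of_segre {g S E : Mat} {ρ : ℝ} (h : IsSegreFrame g S E ρ)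
    {Q : Fin 4 → Fin 4 → Mat} (hcd : ∀ c d, Q c d = -Q d c)
    (hg : ∀ c d, (Q c d)ᵀ * g + g * Q c d = 0) (hsymm : gᵀ = g)
    (hS : ∀ c d, (Q c d)ᵀ * (g * S) + g * S * Q c d = 0)
    (hB : ∀ a b c d, Q c d a b + Q d b a c + Q b c a d = 0)
    (hR : ∀ a b, (g * S) a b = ∑ c, Q c b c a) (a b c d : Fin 4) :
    (g * Q c d) a b - (1 / 2) * (g a c * (g * S) b d - g a d * (g * S) b c
      - g b c * (g * S) a d + g b d * (g * S) a c) = 0 := by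
  set D : Mat := eta * segreDiag ρ with hD
  have hform : Eᵀ * (g * S) * E = D := h.form
  have hDt : Dᵀ = D := by
    rw [hD, eta, segreDiag, Matrix.diagonal_mul_diagonal, Matrix.diagonal_transpose]
  have hSg : Sᵀ * g = g * S := by
    refine h.frame.cancel ?_
    rw [hform, ← hDt, ← hform]
    simp only [Matrix.transpose_mul, Matrix.transpose_transpose, hsymm, Matrix.mul_assoc]
  have hg' : ∀ c d, (g * Q c d)ᵀ = -(g * Q c d) := by
    intro c d
    rw [Matrix.transpose_mul, hsymm, eq_neg_iff_add_eq_zero, hg]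
  -- Invariance of both g and gS under the curvature means that the curvature commutes with S.
  have hcomm : ∀ c d, g * S * Q c d = g * Q c d * S := by
    intro c d
    have h1 := hS c d
    rw [← Matrix.mul_assoc, eq_neg_of_add_eq_zero_left (hg c d)] at h1
    rw [eq_comm, ← sub_eq_zero, ← neg_eq_zero, ← h1]
    noncomm_ring
  let R : Tensor4 := fun a b c d => (g * Q c d) a b
  let Z : Tensor4 := frameComp E R
  have h12 : ∀ i j k l, Z i j k l = -Z j i k l := by
    intro i j k l
    have : R = fun a b c d => (-1) * R b a c d := by
      funext a b c d
      have := congrFun (congrFun (hg' c d) b) a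
      simp only [R, Matrix.transpose_apply, Matrix.neg_apply] at this ⊢
      rw [this]; ring
    simp only [Z]
    conv_lhs => rw [this]
    rw [frameComp_smul, frameComp_swap_left]; ring
  have h34 : ∀ i j k l, Z i j k l = -Z i j l k := by
    intro i j k l
    have : R = fun a b c d => (-1) * R a b d c := by
      funext a b c d
      simp only [R]
      rw [hcd c d, Matrix.mul_neg, Matrix.neg_apply]; ring
    simp only [Z]
    conv_lhs => rw [this]
    rw [frameComp_smul, frameComp_swap_right]; ring
  have hBi : ∀ i j k l, Z i j k l + Z i k l j + Z i l j k = 0 := by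
    intro i j k l
    have h0 : ∀ a b c d, R a b c d + R a c d b + R a d b c = 0 := by
      intro a b c d
      simp only [R, Matrix.mul_apply, ← Finset.sum_add_distrib, ← mul_add]
      exact Finset.sum_eq_zero fun e _ => by rw [hB, mul_zero]
    have e1 : frameComp E (fun a b c d => R a c d b) i j k l = Z i k l j := by
      rw [frameComp_swap_mid E (fun a b c d => R a b d c), frameComp_swap_right]
    have e2 : frameComp E (fun a b c d => R a d b c) i j k l = Z i l j k := by
      rw [frameComp_swap_right E (fun a b c d => R a c b d), frameComp_swap_mid]
    rw [← e1, ← e2, ← frameComp_add, ← frameComp_add]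
    simp only [h0, frameComp, mul_zero, Finset.sum_const_zero]
  have hZ : ∀ i j k l, Z i j k l = ∑ c, ∑ d, E c k * E d l * (Eᵀ * (g * Q c d) * E) i j :=
    fun i j k l => frameComp_eq_matrix E (fun c d => g * Q c d) i j k l
  have hblock : ∀ i j k l, ![ρ, ρ, -ρ, -ρ] i * Z i j k l = Z i j k l * ![ρ, ρ, -ρ, -ρ] j := by
    intro i j k l
    rw [hZ]
    simp only [Finset.mul_sum, Finset.sum_mul]
    refine Finset.sum_congr rfl fun c _ => Finset.sum_congr rfl fun d _ => ?_
    have hm : segreDiag ρ * (Eᵀ * (g * Q c d) * E) = Eᵀ * (g * Q c d) * E * segreDiag ρ := by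
      have h1 : segreDiag ρ * Eᵀ = Eᵀ * Sᵀ := by
        rw [← Matrix.transpose_mul, h.eigen, Matrix.transpose_mul, segreDiag,
          Matrix.diagonal_transpose]
      calc segreDiag ρ * (Eᵀ * (g * Q c d) * E) = (segreDiag ρ * Eᵀ) * g * Q c d * E := by
            simp only [Matrix.mul_assoc]
        _ = Eᵀ * (Sᵀ * g * Q c d) * E := by rw [h1]; simp only [Matrix.mul_assoc]
        _ = Eᵀ * (g * Q c d) * (S * E) := by rw [hSg, hcomm]; simp only [Matrix.mul_assoc]
        _ = _ := by rw [h.eigen]; simp only [Matrix.mul_assoc]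
    have := congrFun (congrFun hm i) j
    simp only [segreDiag, Matrix.mul_diagonal, Matrix.diagonal_mul] at this
    linear_combination (E c k * E d l) * this
  have hRic : ∀ j l, ∑ i, eta i i * Z i j i l = D j l := by
    intro j l
    -- Inserting g⁻¹ = E η Eᵀ rewrites the coordinate trace defining Ric as a frame contraction with
    -- the signs η_ii.
    have hQ : ∀ c d, Q c d = E * eta * Eᵀ * (g * Q c d) := by
      intro c d
      rw [← h.frame.inv_metric, ← Matrix.mul_assoc, Matrix.nonsing_inv_mul _
        (isUnit_iff_ne_zero.2 h.frame.metric_det_ne), Matrix.one_mul]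
    have hq : ∀ b d, (g * S) b d = ∑ c, ∑ a, ∑ i, E c i * eta i i * E a i * (g * Q c d) a b := by
      intro b d
      rw [hR]
      refine Finset.sum_congr rfl fun c _ => ?_
      conv_lhs => rw [hQ c d, Matrix.mul_apply]
      refine Finset.sum_congr rfl fun a _ => ?_
      rw [Matrix.mul_apply, Finset.sum_mul]
      refine Finset.sum_congr rfl fun i _ => ?_
      rw [eta, Matrix.mul_diagonal, Matrix.diagonal_apply_eq, Matrix.transpose_apply]
    rw [← hform, transpose_mul_mul_apply]
    simp only [hq, Z, frameComp, Finset.mul_sum]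
    rw [Finset.sum_congr rfl fun i _ => Finset.sum_comm, Finset.sum_comm]
    refine Finset.sum_congr rfl fun b _ => ?_
    rw [sum_reverse4]
    exact Finset.sum_congr rfl fun d _ => Finset.sum_congr rfl fun c _ =>
      Finset.sum_congr rfl fun a _ => Finset.sum_congr rfl fun i _ => by simp only [R]; ring
  have hcurv := curvature_of_blocks h.ne_zero h12 h34 hBi hblock hRic
  have hg0 : Eᵀ * g * E = eta := h.frame
  have p1 : ∀ i j k l, frameComp E (fun a b c d => g a c * (g * S) b d) i j k l
      = eta i k * D j l := fun i j k l => by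
    rw [frameComp_swap_mid E (fun a b c d => g a b * (g * S) c d), frameComp_prod, hg0, hform]
  have p2 : ∀ i j k l, frameComp E (fun a b c d => g a d * (g * S) b c) i j k l
      = eta i l * D j k := fun i j k l => by
    rw [frameComp_swap_right E (fun a b c d => g a c * (g * S) b d), p1]
  have p3 : ∀ i j k l, frameComp E (fun a b c d => g b c * (g * S) a d) i j k l
      = eta j k * D i l := fun i j k l => by
    rw [frameComp_swap_left E (fun a b c d => g a c * (g * S) b d), p1]
  have p4 : ∀ i j k l, frameComp E (fun a b c d => g b d * (g * S) a c) i j k l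
      = eta j l * D i k := fun i j k l => by
    rw [frameComp_swap_left E (fun a b c d => g a d * (g * S) b c), p2]
  refine eq_zero_of_frameComp (W := fun a b c d => R a b c d - (1 / 2) * (g a c * (g * S) b d
    - g a d * (g * S) b c - g b c * (g * S) a d + g b d * (g * S) a c)) h.frame ?_ a b c d
  intro i j k l
  rw [frameComp_sub, frameComp_smul, frameComp_add, frameComp_sub, frameComp_sub, p1, p2, p3, p4,
    sub_eq_zero]
  exact hcurv i j k l

/-! ### Parallel Ricci tensor, Weyl tensor and Rainich conditions -/

/-- On the open set `U`, `G` is a smooth scalar-flat Yang pure metric of Segré type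
`{(1,1)(11)}`. -/
structure IsYangRegion (G : Coord → Mat) (U : Set Coord) : Prop where
  metric : IsMetricOn G U
  yang : ∀ y ∈ U, YangAt G y
  scalar : ∀ y ∈ U, scalarCurv G y = 0
  segre : ∀ y ∈ U, SegreAt G y

namespace IsYangRegion

variable {G : Coord → Mat} {U : Set Coord}

theorem ricM_symm (h : IsYangRegion G U) {y : Coord} (hy : y ∈ U) : (ricM G y)ᵀ = ricM G y :=
  (exists_isSegreFrame (h.segre y hy) (h.scalar y hy)).1

theorem exists_frame (h : IsYangRegion G U) {y : Coord} (hy : y ∈ U) :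
    ∃ E ρ, IsSegreFrame (G y) (mixM G y) E ρ :=
  (exists_isSegreFrame (h.segre y hy) (h.scalar y hy)).2

theorem ricciSq_eq_trace (G : Coord → Mat) (y : Coord) :
    ricciSq G y = (mixM G y * mixM G y).trace := by
  simp only [ricciSq, Matrix.trace, Matrix.diag, Matrix.mul_apply, mixM, Matrix.of_apply]

theorem ricciSq_eq {y : Coord} {E : Mat} {ρ : ℝ} (hE : IsSegreFrame (G y) (mixM G y) E ρ) :
    ricciSq G y = 4 * ρ ^ 2 := by
  rw [ricciSq_eq_trace, hE.sq, Matrix.trace_smul, Matrix.trace_one]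
  simp; ring

theorem mixM_sq (h : IsYangRegion G U) {y : Coord} (hy : y ∈ U) :
    mixM G y * mixM G y = ((1 / 4) * ricciSq G y) • 1 := by
  obtain ⟨E, ρ, hE⟩ := h.exists_frame hy
  rw [ricciSq_eq hE, hE.sq]
  congr 1; ring

theorem contDiffOn_ricciSq (h : IsYangRegion G U) : ContDiffOn ℝ ∞ (ricciSq G) U := by
  simp only [funext (ricciSq_eq_trace G)]
  exact (h.metric.smooth_mixM.mul h.metric.smooth_mixM).trace

theorem mixM_transpose_mul (h : IsYangRegion G U) {y : Coord} (hy : y ∈ U) :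
    (mixM G y)ᵀ * G y = G y * mixM G y := by
  have hm := h.metric
  rw [hm.mul_mixM hy, ← h.ricM_symm hy, ← hm.mul_mixM hy, Matrix.transpose_mul, hm.symm y hy]

/-- `codazzi_eq_zero` applied to N_a = ∇_a Ric and l_a = ∂_a(R_cd R^cd / 4). Yang's equations give
the first symmetry. -/
theorem nablaForm_ricM_and_pd (h : IsYangRegion G U) {y : Coord} (hy : y ∈ U) :
    (∀ a, nablaForm G (ricM G) a y = 0) ∧ ∀ a, pd a (fun z => (1 / 4) * ricciSq G z) y = 0 := by
  obtain ⟨E, ρ, hE⟩ := h.exists_frame hy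
  have hm := h.metric
  refine codazzi_eq_zero hE (fun a b c => ?_) (fun a => ?_) (fun a => ?_)
  · have := h.yang y hy a b c
    rw [covD2_eq_nablaForm, covD2_eq_nablaForm, sub_eq_zero] at this
    exact this
  · have hp : (pdM a (ricM G) y)ᵀ = pdM a (ricM G) y := by
      rw [← pdM_transpose]
      exact pdM_congr hm.isOpen (fun z hz => h.ricM_symm hz) hy a
    simp only [nablaForm, Matrix.transpose_sub, Matrix.transpose_mul, Matrix.transpose_transpose,
      hp, h.ricM_symm hy]
    abel
  · have hS := h.mixM_transpose_mul hy
    -- The remaining hypothesis is the covariant derivative of S² = (R_cd R^cd / 4)·1, with an index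
    -- lowered.
    have h1 := hm.nablaEnd_mul hm.smooth_mixM hm.smooth_mixM hy a
    have hl : ContDiffOn ℝ ∞ (fun z => (1 / 4) * ricciSq G z) U :=
      contDiffOn_const.mul h.contDiffOn_ricciSq
    rw [hm.nablaEnd_congr (fun z hz => h.mixM_sq hz) hy, nablaEnd,
      pdM_smul hm.isOpen hl (SmoothOn.const 1) hy, pdM_const] at h1
    rw [hm.nablaForm_ricM hy, ← Matrix.mul_assoc, hS, Matrix.mul_assoc, Matrix.mul_assoc,
      ← Matrix.mul_add, ← h1]
    simp

theorem nablaForm_ricM (h : IsYangRegion G U) {y : Coord} (hy : y ∈ U) (a : Fin 4) :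
    nablaForm G (ricM G) a y = 0 := (h.nablaForm_ricM_and_pd hy).1 a

theorem nablaEnd_mixM (h : IsYangRegion G U) {y : Coord} (hy : y ∈ U) (a : Fin 4) :
    nablaEnd G (mixM G) a y = 0 := by
  have := congrArg ((G y)⁻¹ * ·) ((h.metric.nablaForm_ricM hy a).symm.trans (h.nablaForm_ricM hy a))
  simpa only [← Matrix.mul_assoc, h.metric.inv_mul hy, Matrix.one_mul, Matrix.mul_zero] using this

theorem covD2_ricci (h : IsYangRegion G U) {y : Coord} (hy : y ∈ U) (a b c : Fin 4) :
    covD2 G (ricci G) a b c y = 0 := by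
  rw [covD2_eq_nablaForm]
  exact congrFun (congrFun (h.nablaForm_ricM hy a) b) c

/-- Parallel Ric reduces the curvature to its Ricci part by `curvature_of_segre`; the scalar term is
absent as R = 0. -/
theorem weyl_eq_zero (h : IsYangRegion G U) {y : Coord} (hy : y ∈ U) (a b c d : Fin 4) :
    weyl G a b c d y = 0 := by
  obtain ⟨E, ρ, hE⟩ := h.exists_frame hy
  have hm := h.metric
  have := curvature_of_segre hE (Q := fun c d => riemM G c d y) (fun c d => riemM_antisymm G c d y)
    (hm.riemM_metric_skew hy) (hm.symm y hy)
    (fun c d => by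
      rw [hm.mul_mixM hy]
      exact hm.riemM_of_parallel hm.smooth_ricM (fun z hz a => h.nablaForm_ricM hz a) hy c d)
    (hm.bianchi hy) (fun a b => by
      rw [hm.mul_mixM hy]
      rfl) a b c d
  rw [hm.mul_mixM hy] at this
  rw [weyl, h.scalar y hy, zero_div, zero_mul, add_zero]
  exact this

theorem rainichAlgebraicAt (h : IsYangRegion G U) {y : Coord} (hy : y ∈ U) :
    RainichAlgebraicAt G y := by
  constructor
  · intro a c
    have : ricM G y * mixM G y = ((1 / 4) * ricciSq G y) • G y := by
      rw [← h.metric.mul_mixM hy, Matrix.mul_assoc, h.mixM_sq hy]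
      simp
    have := congrFun (congrFun this a) c
    rw [Matrix.mul_apply, Matrix.smul_apply, smul_eq_mul] at this
    exact this.trans (by ring)
  · obtain ⟨E, ρ, hE⟩ := h.exists_frame hy
    rw [ricciSq_eq hE]
    have := hE.ne_zero
    positivity

/-- Every term of the covector contains ∇Ric, so it vanishes on all of `U` and its curl with it. -/
theorem rainichAnalyticAt (h : IsYangRegion G U) {y : Coord} (hy : y ∈ U) :
    RainichAnalyticAt G y := by
  have h0 : ∀ b, ∀ z ∈ U, rainichCovector G b z = 0 := by
    intro b z hz
    simp only [rainichCovector, h.covD2_ricci hz, mul_zero, Finset.sum_const_zero]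
  intro a b
  simp only [covD1, h0 _ y hy, pd_congr_of_isOpen h.metric.isOpen (h0 _) hy, pd_const, mul_zero,
    Finset.sum_const_zero, sub_zero]

/-- Near each point, `R_{ab} R^{ab}` is constant. -/
theorem ricciSq_eq_on_ball (h : IsYangRegion G U) {y : Coord} {r : ℝ}
    (hr : Metric.ball y r ⊆ U) (hpos : 0 < r) :
    ∀ z ∈ Metric.ball y r, ricciSq G z = ricciSq G y := by
  have hd : DifferentiableOn ℝ (ricciSq G) (Metric.ball y r) :=
    (h.contDiffOn_ricciSq.mono hr).differentiableOn (by simp)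
  intro z hz
  refine Metric.isOpen_ball.is_const_of_fderiv_eq_zero (convex_ball y r).isPreconnected hd ?_ hz
    (Metric.mem_ball_self hpos)
  intro w hw
  have hp : ∀ a, pd a (ricciSq G) w = 0 := by
    intro a
    have h1 := (h.nablaForm_ricM_and_pd (hr hw)).2 a
    rw [pd_mul (differentiableAt_const _)
      (differentiableAt_of_contDiffOn h.metric.isOpen h.contDiffOn_ricciSq (hr hw)), pd_const] at h1
    linarith
  ext v
  have hv : v = ∑ a, v a • EuclideanSpace.single a (1 : ℝ) := by
    ext i
    simp [Finset.sum_apply, Pi.single_apply]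
  rw [hv, map_sum]
  simp only [map_smul]
  exact Finset.sum_eq_zero fun a _ => by
    rw [show fderiv ℝ (ricciSq G) w (EuclideanSpace.single a 1) = 0 from hp a, smul_zero]

end IsYangRegion

/-! ### Boosts and rotations of the two eigenplanes -/

/-- The projection onto the span of the first two basis vectors. -/
def timeProj : Mat := Matrix.diagonal ![1, 1, 0, 0]

/-- The projection onto the span of the last two basis vectors. -/
def spaceProj : Mat := Matrix.diagonal ![0, 0, 1, 1]

/-- The infinitesimal boost in the plane of the first two basis vectors. -/
def boost : Mat := !![0, 1, 0, 0; 1, 0, 0, 0; 0, 0, 0, 0; 0, 0, 0, 0]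

/-- The infinitesimal rotation in the plane of the last two basis vectors. -/
def rotation : Mat := !![0, 0, 0, 0; 0, 0, 0, 0; 0, 0, 0, 1; 0, 0, -1, 0]

theorem timeProj_mul_timeProj : timeProj * timeProj = timeProj := by
  rw [timeProj, Matrix.diagonal_mul_diagonal]
  congr 1; ext i; fin_cases i <;> simp

theorem spaceProj_mul_spaceProj : spaceProj * spaceProj = spaceProj := by
  rw [spaceProj, Matrix.diagonal_mul_diagonal]
  congr 1; ext i; fin_cases i <;> simp

theorem boost_mul_boost : boost * boost = timeProj := by
  ext i j
  fin_cases i <;> fin_cases j <;>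
    simp [boost, timeProj, Matrix.mul_apply, Fin.sum_univ_four]

theorem timeProj_mul_boost : timeProj * boost = boost := by
  ext i j
  fin_cases i <;> fin_cases j <;> simp [boost, timeProj]

theorem boost_mul_timeProj : boost * timeProj = boost := by
  ext i j
  fin_cases i <;> fin_cases j <;> simp [boost, timeProj]

theorem eta_boost_transpose : (eta * boost)ᵀ = -(eta * boost) := by
  ext i j
  fin_cases i <;> fin_cases j <;> simp [boost, eta]

/-- The skew endomorphisms of a Lorentzian plane form the line so(1,1). -/
theorem eq_smul_boost {A : Mat} (hA : timeProj * A * timeProj = A)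
    (hs : (eta * A)ᵀ = -(eta * A)) : A = A 0 1 • boost := by
  have h1 : ∀ i j, ![1, 1, 0, 0] i * A i j * ![1, 1, 0, 0] j = A i j := fun i j => by
    have := congrFun (congrFun hA i) j
    simpa only [timeProj, Matrix.mul_diagonal, Matrix.diagonal_mul] using this
  have h2 : ∀ i j, ![-1, 1, 1, 1] j * A j i = -(![-1, 1, 1, 1] i * A i j) := fun i j => by
    have := congrFun (congrFun hs i) j
    simpa only [eta, Matrix.transpose_apply, Matrix.neg_apply, Matrix.diagonal_mul] using this
  have a0 := h2 0 0
  have a1 := h2 1 1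
  have a2 := h2 0 1
  simp at a0 a1 a2
  ext i j
  rw [← h1 i j]
  fin_cases i <;> fin_cases j <;> simp [boost] <;> linarith

/-- The Euclidean counterpart, with so(2). -/
theorem eq_smul_rotation {A : Mat} (hA : spaceProj * A * spaceProj = A)
    (hs : (eta * A)ᵀ = -(eta * A)) : A = A 2 3 • rotation := by
  have h1 : ∀ i j, ![0, 0, 1, 1] i * A i j * ![0, 0, 1, 1] j = A i j := fun i j => by
    have := congrFun (congrFun hA i) j
    simpa only [spaceProj, Matrix.mul_diagonal, Matrix.diagonal_mul] using this
  have h2 : ∀ i j, ![-1, 1, 1, 1] j * A j i = -(![-1, 1, 1, 1] i * A i j) := fun i j => by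
    have := congrFun (congrFun hs i) j
    simpa only [eta, Matrix.transpose_apply, Matrix.neg_apply, Matrix.diagonal_mul] using this
  have a0 := h2 2 2
  have a1 := h2 3 3
  have a2 := h2 2 3
  simp at a0 a1 a2
  ext i j
  rw [← h1 i j]
  fin_cases i <;> fin_cases j <;> simp [rotation] <;> linarith

namespace IsFrame

variable {g E : Mat}

theorem exists_conj (h : IsFrame g E) (A : Mat) : ∃ A', A * E = E * A' :=
  ⟨E⁻¹ * (A * E), by rw [← Matrix.mul_assoc, h.mul_inv, Matrix.one_mul]⟩

theorem cancel_left (h : IsFrame g E) {A B : Mat} (hAB : E * A = E * B) : A = B := by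
  have := congrArg (E⁻¹ * ·) hAB
  simpa only [← Matrix.mul_assoc, h.inv_mul, Matrix.one_mul] using this

theorem trace_conj (h : IsFrame g E) {A A' : Mat} (hA : A * E = E * A') : A.trace = A'.trace := by
  have : A = E * A' * E⁻¹ := by rw [← hA, Matrix.mul_assoc, h.mul_inv, Matrix.mul_one]
  rw [this, Matrix.trace_mul_comm, ← Matrix.mul_assoc, h.inv_mul, Matrix.one_mul]

theorem conj_mul {A A' B B' : Mat} (hA : A * E = E * A') (hB : B * E = E * B') :
    A * B * E = E * (A' * B') := by
  rw [Matrix.mul_assoc, hB, ← Matrix.mul_assoc, hA, Matrix.mul_assoc]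

theorem skew_conj (h : IsFrame g E) {A A' : Mat} (hA : A * E = E * A')
    (hs : (g * A)ᵀ = -(g * A)) : (eta * A')ᵀ = -(eta * A') := by
  have : eta * A' = Eᵀ * (g * A) * E := by
    rw [← show Eᵀ * g * E = eta from h, Matrix.mul_assoc _ E, ← hA]
    simp only [Matrix.mul_assoc]
  rw [this, Matrix.transpose_mul, Matrix.transpose_mul, hs]
  simp [Matrix.mul_assoc]

theorem exists_boost (h : IsFrame g E) {P A : Mat} (hP : P * E = E * timeProj)
    (hA : P * A * P = A) (hs : (g * A)ᵀ = -(g * A)) : ∃ x : ℝ, A * E = E * (x • boost) := by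
  obtain ⟨A', hA'⟩ := h.exists_conj A
  refine ⟨A' 0 1, ?_⟩
  rw [hA', ← eq_smul_boost ?_ (h.skew_conj hA' hs)]
  exact h.cancel_left (by rw [← conj_mul (conj_mul hP hA') hP, hA, hA'])

theorem exists_rotation (h : IsFrame g E) {P A : Mat} (hP : P * E = E * spaceProj)
    (hA : P * A * P = A) (hs : (g * A)ᵀ = -(g * A)) : ∃ x : ℝ, A * E = E * (x • rotation) := by
  obtain ⟨A', hA'⟩ := h.exists_conj A
  refine ⟨A' 2 3, ?_⟩
  rw [hA', ← eq_smul_rotation ?_ (h.skew_conj hA' hs)]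
  exact h.cancel_left (by rw [← conj_mul (conj_mul hP hA') hP, hA, hA'])

/-- The sign of this trace distinguishes a nonzero boost from a rotation, hence the timelike
eigenplane from the spacelike one. -/
theorem trace_sq_of_boost (h : IsFrame g E) {A : Mat} {x : ℝ} (hA : A * E = E * (x • boost)) :
    (A * A).trace = 2 * x ^ 2 := by
  rw [h.trace_conj (conj_mul hA hA)]
  simp [boost_mul_boost, timeProj, Matrix.trace_diagonal,
    Fin.sum_univ_four]
  ring

theorem trace_sq_of_rotation (h : IsFrame g E) {A : Mat} {x : ℝ}
    (hA : A * E = E * (x • rotation)) : (A * A).trace = -(2 * x ^ 2) := by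
  rw [h.trace_conj (conj_mul hA hA)]
  simp [rotation, Matrix.trace, Fin.sum_univ_four]
  ring

end IsFrame

/-- The Ricci projection `(1 + S / ρ) / 2` onto the eigenspace of `ρ`. -/
def ricciProj (G : Coord → Mat) (ρ : ℝ) (y : Coord) : Mat := (1 / 2 : ℝ) • (1 + ρ⁻¹ • mixM G y)

theorem IsSegreFrame.ricciProj_mul {G : Coord → Mat} {y : Coord} {E : Mat} {ρ : ℝ}
    (h : IsSegreFrame (G y) (mixM G y) E ρ) : ricciProj G ρ y * E = E * timeProj := by
  have : timeProj = (1 / 2 : ℝ) • (1 + ρ⁻¹ • segreDiag ρ) := by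
    have := h.ne_zero
    ext i j
    fin_cases i <;> fin_cases j <;> simp [timeProj, segreDiag, this] <;> norm_num
  rw [ricciProj, this]
  simp [Matrix.add_mul, Matrix.mul_add, h.eigen]

/-- Needed where a frame at a nearby point has timelike eigenvalue opposite to the prescribed one.
-/
theorem IsSegreFrame.ricciProj_neg_mul {G : Coord → Mat} {y : Coord} {E : Mat} {ρ : ℝ}
    (h : IsSegreFrame (G y) (mixM G y) E ρ) : ricciProj G (-ρ) y * E = E * spaceProj := by
  have : spaceProj = (1 / 2 : ℝ) • (1 + (-ρ)⁻¹ • segreDiag ρ) := by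
    have := h.ne_zero
    ext i j
    fin_cases i <;> fin_cases j <;> simp [spaceProj, segreDiag, this] <;> norm_num
  rw [ricciProj, this]
  simp [Matrix.add_mul, Matrix.mul_add, h.eigen]

/-! ### Parallel boost fields -/

/-- On `V` the endomorphism field `J` is the unit boost generator of the timelike eigenplane of the
Ricci tensor, whose eigenvalue there is the constant `ρ`. -/
structure IsBoostField (G : Coord → Mat) (ρ : ℝ) (J : Coord → Mat) (V : Set Coord) : Prop where
  region : IsYangRegion G V
  smooth : SmoothOn J V
  skew : ∀ y ∈ V, (G y * J y)ᵀ = -(G y * J y)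
  frame : ∀ y ∈ V, ∃ E x, IsSegreFrame (G y) (mixM G y) E ρ ∧ x ^ 2 = 1 ∧
    J y * E = E * ((x : ℝ) • boost)

namespace IsYangRegion

variable {G : Coord → Mat} {U : Set Coord}

theorem mono (h : IsYangRegion G U) {V : Set Coord} (hV : IsOpen V) (hVU : V ⊆ U) :
    IsYangRegion G V :=
  ⟨h.metric.mono hV hVU, fun y hy => h.yang y (hVU hy), fun y hy => h.scalar y (hVU hy),
    fun y hy => h.segre y (hVU hy)⟩

theorem smooth_ricciProj (h : IsYangRegion G U) (ρ : ℝ) : SmoothOn (ricciProj G ρ) U :=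
  SmoothOn.smul contDiffOn_const
    ((SmoothOn.const 1).add (SmoothOn.smul contDiffOn_const h.metric.smooth_mixM))

theorem ricciProj_transpose_mul (h : IsYangRegion G U) (ρ : ℝ) {y : Coord} (hy : y ∈ U) :
    (ricciProj G ρ y)ᵀ * G y = G y * ricciProj G ρ y := by
  simp only [ricciProj, Matrix.transpose_smul, Matrix.transpose_add, Matrix.transpose_one,
    Matrix.smul_mul, Matrix.mul_smul, Matrix.add_mul, Matrix.mul_add, h.mixM_transpose_mul hy,
    Matrix.one_mul, Matrix.mul_one]

theorem nablaEnd_ricciProj (h : IsYangRegion G U) (ρ : ℝ) {y : Coord} (hy : y ∈ U) (a : Fin 4) :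
    nablaEnd G (ricciProj G ρ) a y = 0 := by
  have hm := h.metric
  have e : pdM a (ricciProj G ρ) y = (1 / 2 : ℝ) • ρ⁻¹ • pdM a (mixM G) y := by
    unfold ricciProj
    rw [pdM_smul hm.isOpen contDiffOn_const
        ((SmoothOn.const 1).add (SmoothOn.smul contDiffOn_const hm.smooth_mixM)) hy,
      pdM_add hm.isOpen (SmoothOn.const 1) (SmoothOn.smul contDiffOn_const hm.smooth_mixM) hy,
      pdM_smul hm.isOpen contDiffOn_const hm.smooth_mixM hy, pdM_const, pd_const, pd_const]
    simp
  have e2 : nablaEnd G (ricciProj G ρ) a y = (1 / 2 : ℝ) • ρ⁻¹ • nablaEnd G (mixM G) a y := by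
    simp only [nablaEnd, e, ricciProj, Matrix.mul_smul, Matrix.smul_mul, Matrix.mul_add,
      Matrix.add_mul, Matrix.one_mul, Matrix.mul_one, smul_sub, smul_add]
    abel
  rw [e2, h.nablaEnd_mixM hy, smul_zero, smul_zero]

/-- Around each point there is a boost field, which may be prescribed at that point. -/
theorem exists_boostField (h : IsYangRegion G U) {y : Coord} (hy : y ∈ U) {E : Mat} {ρ : ℝ}
    (hE : IsSegreFrame (G y) (mixM G y) E ρ) :
    ∃ V J, y ∈ V ∧ V ⊆ U ∧ IsBoostField G ρ J V ∧ J y * E = E * boost := by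
  obtain ⟨r, hr, hball⟩ := Metric.isOpen_iff.1 h.metric.isOpen y hy
  have hb := h.mono Metric.isOpen_ball hball
  have hm := hb.metric
  have hym : y ∈ Metric.ball y r := Metric.mem_ball_self hr
  set A₀ : Mat := E * boost * E⁻¹ with hA₀
  have hA₀E : A₀ * E = E * boost := by
    rw [hA₀, Matrix.mul_assoc, hE.frame.inv_mul, Matrix.mul_one]
  -- The boost at `y` is extended by constant components of its two-form, which keeps it skew;
  -- projecting on both sides by P and rescaling then gives a smooth boost field.
  set B₀ : Mat := G y * A₀ with hB₀
  have hB₀s : B₀ᵀ = -B₀ := by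
    refine hE.frame.cancel ?_
    have e : Eᵀ * B₀ * E = eta * boost := by
      rw [hB₀, Matrix.mul_assoc, Matrix.mul_assoc, hA₀E, ← Matrix.mul_assoc, ← Matrix.mul_assoc,
        show Eᵀ * G y * E = eta from hE.frame]
    have e' : Eᵀ * B₀ᵀ * E = (Eᵀ * B₀ * E)ᵀ := by
      simp only [Matrix.transpose_mul, Matrix.transpose_transpose, Matrix.mul_assoc]
    rw [e', e, eta_boost_transpose, Matrix.mul_neg, Matrix.neg_mul, e]
  let P := ricciProj G ρ
  let J₀ : Coord → Mat := fun z => P z * ((G z)⁻¹ * B₀) * P z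
  have hPs : SmoothOn P (Metric.ball y r) := hb.smooth_ricciProj ρ
  have hJ₀s : SmoothOn J₀ (Metric.ball y r) :=
    (hPs.mul (hm.smooth_inv.mul (SmoothOn.const B₀))).mul hPs
  let μ : Coord → ℝ := fun z => (1 / 2) * (J₀ z * J₀ z).trace
  have hμs : ContDiffOn ℝ ∞ μ (Metric.ball y r) :=
    contDiffOn_const.mul (hJ₀s.mul hJ₀s).trace
  have hJ₀y : J₀ y * E = E * boost := by
    have hP : P y * E = E * timeProj := hE.ricciProj_mul
    have h1 : (G y)⁻¹ * B₀ * E = E * boost := by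
      rw [hB₀, ← Matrix.mul_assoc, hm.inv_mul hym, Matrix.one_mul, hA₀E]
    rw [IsFrame.conj_mul (IsFrame.conj_mul hP h1) hP, timeProj_mul_boost, boost_mul_timeProj]
  have hμy : μ y = 1 := by
    simp only [μ]
    rw [hE.frame.trace_sq_of_boost (x := 1) (by rw [one_smul, hJ₀y])]
    norm_num
  have hskew : ∀ z ∈ Metric.ball y r, (G z * J₀ z)ᵀ = -(G z * J₀ z) := by
    intro z hz
    have e : G z * J₀ z = (P z)ᵀ * B₀ * P z := by
      simp only [J₀]
      rw [← Matrix.mul_assoc, ← Matrix.mul_assoc, ← hb.ricciProj_transpose_mul ρ hz,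
        Matrix.mul_assoc _ (G z), ← Matrix.mul_assoc (G z), hm.mul_inv hz, Matrix.one_mul]
    rw [e]
    simp only [Matrix.transpose_mul, Matrix.transpose_transpose, hB₀s]
    simp [Matrix.mul_assoc]
  -- Constancy of ρ² still allows the timelike eigenvalue at `z` to be -ρ. Then P would be the
  -- spacelike projection and `J₀ z` a rotation, giving `μ z ≤ 0`.
  have hkey : ∀ z ∈ Metric.ball y r, 0 < μ z → ∃ E' x, IsSegreFrame (G z) (mixM G z) E' ρ ∧
      J₀ z * E' = E' * ((x : ℝ) • boost) ∧ μ z = x ^ 2 := by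
    intro z hz hpos
    obtain ⟨E', ρ', hE'⟩ := hb.exists_frame hz
    have hsq : ρ' ^ 2 = ρ ^ 2 := by
      have := h.ricciSq_eq_on_ball hball hr z hz
      rw [ricciSq_eq hE', ricciSq_eq hE] at this
      linarith
    rcases sq_eq_sq_iff_eq_or_eq_neg.1 hsq with rfl | hneg
    · have hP : P z * E' = E' * timeProj := hE'.ricciProj_mul
      have hPP : P z * P z = P z := hE'.frame.cancel_right (by
        rw [IsFrame.conj_mul hP hP, hP, timeProj_mul_timeProj])
      obtain ⟨x, hx⟩ := hE'.frame.exists_boost hP (A := J₀ z) (by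
        simp only [J₀]
        rw [show ∀ X : Mat, P z * (P z * X * P z) * P z = (P z * P z) * X * (P z * P z) from
          fun X => by simp only [Matrix.mul_assoc], hPP]) (hskew z hz)
      refine ⟨E', x, hE', hx, ?_⟩
      simp only [μ, hE'.frame.trace_sq_of_boost hx]
      ring
    · exfalso
      have hP : P z * E' = E' * spaceProj := by
        have := hE'.ricciProj_neg_mul
        rwa [hneg, neg_neg] at this
      have hPP : P z * P z = P z := hE'.frame.cancel_right (by
        rw [IsFrame.conj_mul hP hP, hP, spaceProj_mul_spaceProj])
      obtain ⟨x, hx⟩ := hE'.frame.exists_rotation hP (A := J₀ z) (by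
        simp only [J₀]
        rw [show ∀ X : Mat, P z * (P z * X * P z) * P z = (P z * P z) * X * (P z * P z) from
          fun X => by simp only [Matrix.mul_assoc], hPP]) (hskew z hz)
      simp only [μ, hE'.frame.trace_sq_of_rotation hx] at hpos
      nlinarith [sq_nonneg x]
  let V : Set Coord := Metric.ball y r ∩ μ ⁻¹' Set.Ioi 0
  have hVo : IsOpen V := hμs.continuousOn.isOpen_inter_preimage Metric.isOpen_ball isOpen_Ioi
  have hVb : V ⊆ Metric.ball y r := Set.inter_subset_left
  refine ⟨V, fun z => (Real.sqrt (μ z))⁻¹ • J₀ z, ⟨hym, by simp [hμy]⟩, hVb.trans hball,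
    ⟨hb.mono hVo hVb, ?_, ?_, ?_⟩, ?_⟩
  · refine SmoothOn.smul (ContDiffOn.inv ?_ ?_) (hJ₀s.mono hVb)
    · exact ContDiffOn.sqrt (hμs.mono hVb) fun z hz => (ne_of_gt hz.2)
    · exact fun z hz => (Real.sqrt_pos.2 hz.2).ne'
  · intro z hz
    simp only [Matrix.mul_smul, Matrix.transpose_smul, hskew z (hVb hz), smul_neg]
  · intro z hz
    obtain ⟨E', x, hE', hx, hμ⟩ := hkey z (hVb hz) hz.2
    refine ⟨E', (Real.sqrt (μ z))⁻¹ * x, hE', ?_, ?_⟩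
    · have hz2 : 0 < μ z := hz.2
      rw [mul_pow, inv_pow, Real.sq_sqrt hz2.le, ← hμ, inv_mul_cancel₀ hz2.ne']
    · simp only [Matrix.smul_mul, hx, Matrix.mul_smul, mul_smul]
  · simp only [hμy, Real.sqrt_one, inv_one, one_smul, hJ₀y]

end IsYangRegion

namespace IsBoostField

variable {G : Coord → Mat} {ρ : ℝ} {J : Coord → Mat} {V : Set Coord}

theorem mono (h : IsBoostField G ρ J V) {W : Set Coord} (hW : IsOpen W) (hWV : W ⊆ V) :
    IsBoostField G ρ J W :=
  ⟨h.region.mono hW hWV, h.smooth.mono hWV, fun y hy => h.skew y (hWV hy),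
    fun y hy => h.frame y (hWV hy)⟩

theorem mul_self (h : IsBoostField G ρ J V) {y : Coord} (hy : y ∈ V) :
    J y * J y = ricciProj G ρ y := by
  obtain ⟨E, x, hE, hx, hJ⟩ := h.frame y hy
  refine hE.frame.cancel_right ?_
  have hxb : x • boost * (x • boost) = timeProj := by
    rw [Matrix.smul_mul, Matrix.mul_smul, smul_smul, boost_mul_boost, ← sq, hx, one_smul]
  rw [IsFrame.conj_mul hJ hJ, hE.ricciProj_mul, hxb]

theorem ricciProj_mul_mul (h : IsBoostField G ρ J V) {y : Coord} (hy : y ∈ V) :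
    ricciProj G ρ y * J y * ricciProj G ρ y = J y := by
  obtain ⟨E, x, hE, hx, hJ⟩ := h.frame y hy
  refine hE.frame.cancel_right ?_
  rw [IsFrame.conj_mul (IsFrame.conj_mul hE.ricciProj_mul hJ) hE.ricciProj_mul, hJ,
    Matrix.mul_smul, Matrix.smul_mul, timeProj_mul_boost, boost_mul_timeProj]

/-- A boost field is parallel. -/
theorem nablaEnd_eq_zero (h : IsBoostField G ρ J V) {y : Coord} (hy : y ∈ V) (a : Fin 4) :
    nablaEnd G J a y = 0 := by
  have hm := h.region.metric
  have hPs := h.region.smooth_ricciProj ρ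
  have hDP := h.region.nablaEnd_ricciProj ρ hy a
  set N := nablaEnd G J a y with hN
  -- Differentiating the skewness of J and PJP = J shows that ∇J is again a boost of the same plane,
  -- hence proportional to J.
  have hNskew : (G y * N)ᵀ = -(G y * N) := by
    rw [hN, ← hm.nablaForm_lower h.smooth hy]
    have hp : (pdM a (fun z => G z * J z) y)ᵀ = -pdM a (fun z => G z * J z) y := by
      rw [← pdM_transpose, pdM_congr hm.isOpen h.skew hy]
      ext i j
      simp [pdM_apply, pd]
    simp only [nablaForm, Matrix.transpose_sub, hp, Matrix.transpose_mul (gammaM G a y)ᵀ,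
      Matrix.transpose_mul _ (gammaM G a y), h.skew y hy, Matrix.transpose_transpose]
    noncomm_ring
  have hPNP : ricciProj G ρ y * N * ricciProj G ρ y = N := by
    have h1 := hm.nablaEnd_mul (hPs.mul h.smooth) hPs hy a
    rw [hm.nablaEnd_mul hPs h.smooth hy, hDP,
      hm.nablaEnd_congr (fun z hz => h.ricciProj_mul_mul hz) hy] at h1
    simpa using h1.symm
  -- Derivative of J² = P with ∇P = 0. Being both proportional to J and anticommuting with it, ∇J
  -- vanishes.
  have hanti : N * J y + J y * N = 0 := by
    rw [hN, ← hm.nablaEnd_mul h.smooth h.smooth hy, ← hDP]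
    exact hm.nablaEnd_congr (fun z hz => h.mul_self hz) hy a
  obtain ⟨E, x, hE, hx, hJ⟩ := h.frame y hy
  obtain ⟨t, ht⟩ := hE.frame.exists_boost hE.ricciProj_mul hPNP hNskew
  have h2 : E * ((2 * t * x) • timeProj) = E * 0 := by
    rw [Matrix.mul_zero, ← Matrix.zero_mul E, ← hanti, Matrix.add_mul, IsFrame.conj_mul ht hJ,
      IsFrame.conj_mul hJ ht, ← Matrix.mul_add]
    congr 1
    rw [Matrix.smul_mul, Matrix.mul_smul, smul_smul, Matrix.smul_mul, Matrix.mul_smul, smul_smul,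
      boost_mul_boost, ← add_smul]
    congr 1; ring
  have h3 : 2 * t * x = 0 := by
    simpa [timeProj] using congrFun (congrFun (hE.frame.cancel_left h2) 0) 0
  have hx0 : x ≠ 0 := by rintro rfl; norm_num at hx
  have ht0 : t = 0 := by
    rcases mul_eq_zero.1 h3 with h4 | h4
    · linarith
    · exact absurd h4 hx0
  refine hE.frame.cancel_right ?_
  rw [ht, ht0, zero_smul, Matrix.mul_zero, Matrix.zero_mul]

theorem trace_ricciProj (h : IsBoostField G ρ J V) {y : Coord} (hy : y ∈ V) :
    (ricciProj G ρ y).trace = 2 := by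
  obtain ⟨E, x, hE, -, -⟩ := h.frame y hy
  rw [hE.frame.trace_conj hE.ricciProj_mul]
  simp [timeProj, Matrix.trace_diagonal, Fin.sum_univ_four]
  norm_num

/-- If the Ricci eigenvalue of the timelike plane is negative, a multiple of the boost field is a
non-null solution of the Einstein–Maxwell equations. -/
theorem isNonNullEinsteinMaxwellField (h : IsBoostField G ρ J V) (hρ : ρ < 0) :
    IsNonNullEinsteinMaxwellField G
      (fun a b z => (Real.sqrt (-ρ / (4 * Real.pi)) • (G z * J z)) a b) V := by
  have hm := h.region.metric
  -- For F = c·gJ one finds F_ac F_b^c = -c² gP and F_cd F^cd = -2c², so T = -(c²/2) g(2P - 1) =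
  -- -(c²/2ρ) Ric. Then 8πT = Ric forces c² = -ρ/(4π).
  set c : ℝ := Real.sqrt (-ρ / (4 * Real.pi)) with hc
  have hc2 : c ^ 2 = -ρ / (4 * Real.pi) :=
    Real.sq_sqrt (div_nonneg (by linarith) (by positivity))
  have hcpos : 0 < c ^ 2 := by
    rw [hc2]; exact div_pos (by linarith) (by positivity)
  let F : Coord → Mat := fun z => c • (G z * J z)
  have hinv : ∀ y ∈ V, ((G y)⁻¹)ᵀ = (G y)⁻¹ := fun y hy => by
    rw [Matrix.transpose_nonsing_inv, hm.symm y hy]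
  have hFs : SmoothOn F V := SmoothOn.smul contDiffOn_const (hm.smooth.mul h.smooth)
  have hFt : ∀ y ∈ V, (F y)ᵀ = -F y := fun y hy => by
    simp only [F, Matrix.transpose_smul, h.skew y hy, smul_neg]
  have hGF : ∀ y ∈ V, (G y)⁻¹ * F y = c • J y := fun y hy => by
    simp only [F, Matrix.mul_smul, ← Matrix.mul_assoc, hm.inv_mul hy, Matrix.one_mul]
  have hsq : ∀ y ∈ V, fieldSq G (fun a b z => F z a b) y = -(2 * c ^ 2) := by
    intro y hy
    have e : fieldSq G (fun a b z => F z a b) y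
        = (F y * ((G y)⁻¹ * F y * ((G y)⁻¹)ᵀ)ᵀ).trace := by
      simp only [fieldSq, raise2, Matrix.trace, Matrix.diag, ginv]
      refine Finset.sum_congr rfl fun a _ => ?_
      rw [Matrix.mul_apply]
      refine Finset.sum_congr rfl fun b _ => ?_
      rw [Matrix.transpose_apply, Matrix.mul_apply, Finset.sum_comm]
      congr 1
      refine Finset.sum_congr rfl fun d _ => ?_
      rw [Matrix.mul_apply, Finset.sum_mul]
      exact Finset.sum_congr rfl fun c _ => by rw [Matrix.transpose_apply]; ring
    rw [e, Matrix.transpose_mul, Matrix.transpose_mul, Matrix.transpose_transpose, hFt y hy,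
      hinv y hy, Matrix.trace_mul_comm]
    rw [show (G y)⁻¹ * (-F y * (G y)⁻¹) * F y = -(((G y)⁻¹ * F y) * ((G y)⁻¹ * F y)) by
      noncomm_ring, hGF y hy, Matrix.smul_mul, Matrix.mul_smul, h.mul_self hy, Matrix.trace_neg,
      Matrix.trace_smul, Matrix.trace_smul, h.trace_ricciProj hy]
    simp only [smul_eq_mul]; ring
  -- F is parallel, so both Maxwell equations hold term by term.
  have hnab : ∀ y ∈ V, ∀ a, nablaForm G F a y = 0 := by
    intro y hy a
    have hcJ : SmoothOn (fun z => c • J z) V := SmoothOn.smul contDiffOn_const h.smooth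
    have e : F = fun z => G z * (c • J z) := funext fun z => by simp only [F, Matrix.mul_smul]
    have e2 : nablaEnd G (fun z => c • J z) a y = c • nablaEnd G J a y := by
      simp only [nablaEnd, pdM_smul hm.isOpen contDiffOn_const h.smooth hy, pd_const, zero_smul,
        zero_add, Matrix.mul_smul, Matrix.smul_mul, smul_sub, smul_add]
    rw [e, hm.nablaForm_lower hcJ hy, e2, h.nablaEnd_eq_zero hy, smul_zero, Matrix.mul_zero]
  have hcov : ∀ y ∈ V, ∀ a b d, covD2 G (fun a b z => F z a b) a b d y = 0 := by
    intro y hy a b d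
    rw [covD2_eq_nablaForm]
    exact congrFun (congrFun (hnab y hy a) b) d
  change IsNonNullEinsteinMaxwellField G (fun a b z => F z a b) V
  refine ⟨fun a b => hFs a b, fun y hy a b => ?_, fun y hy => Or.inl ?_, fun y hy => ⟨?_, ?_⟩,
    fun y hy a b => ?_⟩
  · exact congrFun (congrFun (hFt y hy) b) a
  · rw [hsq y hy]
    linarith
  · intro a b d
    rw [hcov y hy, hcov y hy, hcov y hy, add_zero, add_zero]
  · intro b
    refine Finset.sum_eq_zero fun a _ => Finset.sum_eq_zero fun d _ => ?_
    rw [hcov y hy, mul_zero]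
  · have e : emTensor G (fun a b z => F z a b) a b y
        = (F y * (G y)⁻¹ * (F y)ᵀ) a b - (1 / 4) * fieldSq G (fun a b z => F z a b) y * G y a b := by
      rw [emTensor, Matrix.mul_apply, Finset.sum_comm]
      congr 1
      refine Finset.sum_congr rfl fun d _ => ?_
      rw [Matrix.mul_apply, Finset.sum_mul]
      exact Finset.sum_congr rfl fun c _ => by rw [Matrix.transpose_apply, ginv]; ring
    have e2 : F y * (G y)⁻¹ * (F y)ᵀ = -(c ^ 2) • (G y * ricciProj G ρ y) := by
      rw [hFt y hy, Matrix.mul_neg, Matrix.mul_assoc, hGF y hy, ← h.mul_self hy]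
      simp only [F, Matrix.smul_mul, Matrix.mul_smul, smul_smul, ← sq, neg_smul, Matrix.mul_assoc]
    have e3 : (G y * ricciProj G ρ y) a b = (1 / 2) * (G y a b + ρ⁻¹ * ricci G a b y) := by
      rw [ricciProj, Matrix.mul_smul, Matrix.mul_add, Matrix.mul_one, Matrix.mul_smul,
        hm.mul_mixM hy]
      rfl
    rw [h.region.scalar y hy, e, e2, Matrix.smul_apply, e3,
      hsq y hy, hc2, smul_eq_mul]
    have := hρ.ne
    have := Real.pi_ne_zero
    field_simp
    ring

/-- The null vectors of a boost field span a Kundt congruence. -/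
theorem isKundtField (h : IsBoostField G ρ J V) {w : Fin 4 → ℝ}
    (hw : ∀ y ∈ V, ∃ a, ((J y + ricciProj G ρ y) *ᵥ w) a ≠ 0) :
    IsKundtField G (fun a z => ((J z + ricciProj G ρ z) *ᵥ w) a) V := by
  have hm := h.region.metric
  -- Every column is `w`, so column 0 of `L z * C` is the vector `L z *ᵥ w` and the matrix calculus
  -- applies to it.
  let C : Mat := Matrix.of fun i _ => w i
  let L : Coord → Mat := fun z => J z + ricciProj G ρ z
  have hLs : SmoothOn L V := h.smooth.add (h.region.smooth_ricciProj ρ)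
  have hLC : ∀ z a, ((J z + ricciProj G ρ z) *ᵥ w) a = (L z * C) a 0 := fun z a => rfl
  -- In the frame, J + P = x·boost + timeProj with x² = 1 is the square of the null vector (1, x, 0,
  -- 0), so the image is a null line.
  have hLrank : ∀ y ∈ V, ∃ p q : Fin 4 → ℝ, L y = Matrix.vecMulVec p q ∧ p ⬝ᵥ (G y *ᵥ p) = 0 := by
    intro y hy
    obtain ⟨E, x, hE, hx, hJ⟩ := h.frame y hy
    have hLE : L y * E = E * (x • boost + timeProj) := by
      simp only [L]
      rw [Matrix.add_mul, hJ, hE.ricciProj_mul, Matrix.mul_add]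
    have hr : x • boost + timeProj = Matrix.vecMulVec ![1, x, 0, 0] ![1, x, 0, 0] := by
      ext i j
      fin_cases i <;> fin_cases j <;>
        simp [boost, timeProj, Matrix.vecMulVec_apply, ← sq, hx]
    refine ⟨E *ᵥ ![1, x, 0, 0], ![1, x, 0, 0] ᵥ* E⁻¹, ?_, ?_⟩
    · rw [← Matrix.vecMulVec_mul, ← Matrix.mul_vecMulVec, ← hr, ← hLE, Matrix.mul_assoc,
        hE.frame.mul_inv, Matrix.mul_one]
    · rw [Matrix.dotProduct_mulVec, Matrix.vecMul_mulVec, ← Matrix.dotProduct_mulVec,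
        Matrix.mulVec_mulVec, show Eᵀ * G y * E = eta from hE.frame]
      simp [eta, Matrix.mulVec_diagonal, dotProduct, Fin.sum_univ_four]
      nlinarith [hx]
  have hDL : ∀ y ∈ V, ∀ b, pdM b L y + gammaM G b y * L y = L y * gammaM G b y := by
    intro y hy b
    have h1 := h.nablaEnd_eq_zero hy b
    have h2 := h.region.nablaEnd_ricciProj ρ hy b
    have h3 : nablaEnd G L b y = nablaEnd G J b y + nablaEnd G (ricciProj G ρ) b y := by
      simp only [nablaEnd, L, pdM_add hm.isOpen h.smooth (h.region.smooth_ricciProj ρ) hy]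
      noncomm_ring
    rw [h1, h2, add_zero, nablaEnd, sub_eq_zero] at h3
    exact h3
  -- As L is parallel and `w` has constant components, ∇_b(Lw) = L Γ_b w, which lies in the image of
  -- L and is thus proportional to k.
  have hcov : ∀ y ∈ V, ∀ a b, covD1 G (lower G fun a z => ((J z + ricciProj G ρ z) *ᵥ w) a) b a y
      = (G y * (L y * (gammaM G b y * C))) a 0 := by
    intro y hy a b
    have hCs : SmoothOn (fun _ => C) V := SmoothOn.const C
    have hA : SmoothOn (fun z => L z * C) V := hLs.mul hCs
    have e : covD1 G (lower G fun a z => ((J z + ricciProj G ρ z) *ᵥ w) a) b a y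
        = (pdM b (fun z => G z * (L z * C)) y - (gammaM G b y)ᵀ * (G y * (L y * C))) a 0 := rfl
    rw [e, pdM_mul hm.isOpen hm.smooth hA hy, pdM_mul hm.isOpen hLs hCs hy, pdM_const,
      hm.pdM_metric hy, ← Matrix.mul_assoc (L y), ← hDL y hy]
    refine congrFun (congrFun ?_ a) 0
    noncomm_ring
  have hL : ∀ y ∈ V, ∀ p q : Fin 4 → ℝ, L y = Matrix.vecMulVec p q → ∀ (B : Mat) (i : Fin 4),
      (L y * B) i 0 = p i * ∑ j, q j * B j 0 := by
    intro y hy p q hpq B i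
    rw [hpq, Matrix.mul_apply, Finset.mul_sum]
    exact Finset.sum_congr rfl fun j _ => by rw [Matrix.vecMulVec_apply]; ring
  refine ⟨fun a => ?_, hw, fun y hy => ?_, fun y hy X Y hX hY => ?_⟩
  · exact (hLs.mul (SmoothOn.const C)) a 0
  · obtain ⟨p, q, hpq, hnull⟩ := hLrank y hy
    simp only [lower, hLC, hL y hy p q hpq]
    set s := ∑ j, q j * C j 0
    have : ∑ a, (∑ b, G y a b * (p b * s)) * (p a * s) = s ^ 2 * (p ⬝ᵥ (G y *ᵥ p)) := by
      simp only [dotProduct, Matrix.mulVec, Finset.mul_sum, Finset.sum_mul]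
      exact Finset.sum_congr rfl fun a _ => Finset.sum_congr rfl fun b _ => by ring
    rw [this, hnull, mul_zero]
  · obtain ⟨p, q, hpq, -⟩ := hLrank y hy
    obtain ⟨a₀, ha₀⟩ := hw y hy
    have hs : ∑ j, q j * C j 0 ≠ 0 := by
      intro h0
      rw [hLC, hL y hy p q hpq, h0, mul_zero] at ha₀
      exact ha₀ rfl
    simp only [lower, hLC, hL y hy p q hpq] at hX
    -- Since k = s·p with s ≠ 0, orthogonality to k is orthogonality to p, hence to every ∇_b k. The
    -- condition on `Y` plays no role in this cancellation.
    have hX' : ∑ a, (∑ b, G y a b * p b) * X a = 0 := by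
      refine (mul_eq_zero.1 (?_ : (∑ a, (∑ b, G y a b * p b) * X a) * (∑ j, q j * C j 0) = 0)
        ).resolve_right hs
      rw [← hX, Finset.sum_mul]
      refine Finset.sum_congr rfl fun a _ => ?_
      rw [Finset.sum_mul, Finset.sum_mul, Finset.sum_mul]
      exact Finset.sum_congr rfl fun b _ => by ring
    simp only [hcov y hy]
    rw [Finset.sum_comm]
    refine Finset.sum_eq_zero fun b _ => ?_
    have : ∀ a, (G y * (L y * (gammaM G b y * C))) a 0
        = (∑ i, G y a i * p i) * ∑ j, q j * (gammaM G b y * C) j 0 := by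
      intro a
      rw [Matrix.mul_apply, Finset.sum_mul]
      exact Finset.sum_congr rfl fun i _ => by rw [hL y hy p q hpq]; ring
    rw [← zero_mul (Y b * ∑ j, q j * (gammaM G b y * C) j 0), ← hX', Finset.sum_mul]
    exact Finset.sum_congr rfl fun a _ => by rw [this]; ring

end IsBoostField

/-! ### Local existence and passage to the manifold -/

namespace IsYangRegion

variable {G : Coord → Mat} {U : Set Coord}

/-- On the unit timelike eigenvector u, Ric(u,u) = ρ g(u,u) = -ρ. -/
theorem eigenvalue_neg {y : Coord} {E : Mat} {ρ : ℝ} (h : IsYangRegion G U) (hy : y ∈ U)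
    (hE : IsSegreFrame (G y) (mixM G y) E ρ) (hen : EnergyAt G y) : ρ < 0 := by
  have h1 : ∑ a, ∑ b, G y a b * E a 0 * E b 0 = -1 := by
    have := congrFun (congrFun (show Eᵀ * G y * E = eta from hE.frame) 0) 0
    rw [transpose_mul_mul_apply] at this
    refine Eq.trans ?_ (this.trans (by simp [eta]))
    exact Finset.sum_congr rfl fun a _ => Finset.sum_congr rfl fun b _ => by ring
  have h2 : ∑ a, ∑ b, ricci G a b y * E a 0 * E b 0 = -ρ := by
    have := congrFun (congrFun hE.form 0) 0
    rw [transpose_mul_mul_apply, h.metric.mul_mixM hy] at this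
    refine Eq.trans ?_ (this.trans (by simp [eta, segreDiag]))
    exact Finset.sum_congr rfl fun a _ => Finset.sum_congr rfl fun b _ => by
      rw [ricM, Matrix.of_apply]; ring
  have h3 := hen (fun a => E a 0) (by rw [h1]; norm_num)
  rw [h2] at h3
  exact lt_of_le_of_ne (by linarith) hE.ne_zero

theorem exists_einsteinMaxwell (h : IsYangRegion G U) {y : Coord} (hy : y ∈ U)
    (hen : EnergyAt G y) :
    ∃ V : Set Coord, IsOpen V ∧ y ∈ V ∧ V ⊆ U ∧ ∃ F, IsNonNullEinsteinMaxwellField G F V := by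
  obtain ⟨E, ρ, hE⟩ := h.exists_frame hy
  obtain ⟨V, J, hyV, hVU, hJ, -⟩ := h.exists_boostField hy hE
  exact ⟨V, hJ.region.metric.isOpen, hyV, hVU, _,
    hJ.isNonNullEinsteinMaxwellField (h.eigenvalue_neg hy hE hen)⟩

theorem exists_kundt (h : IsYangRegion G U) {y : Coord} (hy : y ∈ U) :
    ∃ V : Set Coord, IsOpen V ∧ y ∈ V ∧ V ⊆ U ∧ ∃ k, IsKundtField G k V := by
  obtain ⟨E, ρ, hE⟩ := h.exists_frame hy
  obtain ⟨V, J, hyV, hVU, hJ, hJy⟩ := h.exists_boostField hy hE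
  -- With `w` the timelike frame vector at `y`, k(y) is the sum of the first two frame vectors and
  -- so nonzero; shrinking to where one component stays nonzero makes k nowhere zero.
  let w : Fin 4 → ℝ := fun a => E a 0
  let k : Fin 4 → Coord → ℝ := fun a z => ((J z + ricciProj G ρ z) *ᵥ w) a
  have hk : ∀ a, ContDiffOn ℝ ∞ (k a) V := fun a =>
    ((hJ.smooth.add (hJ.region.smooth_ricciProj ρ)).mul
      (SmoothOn.const (Matrix.of fun i _ => w i))) a 0
  have hne : ∃ a, k a y ≠ 0 := by
    by_contra! h0
    have h1 : (J y + ricciProj G ρ y) * E = E * (boost + timeProj) := by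
      rw [Matrix.add_mul, hJy, hE.ricciProj_mul, Matrix.mul_add]
    have h2 : ∀ a, E a 0 + E a 1 = 0 := by
      intro a
      have h3 : ((J y + ricciProj G ρ y) * E) a 0 = 0 := h0 a
      rw [h1, Matrix.mul_apply] at h3
      simpa [Fin.sum_univ_four, boost, timeProj] using h3
    have h4 : E *ᵥ ![1, 1, 0, 0] = 0 := by
      ext a
      simpa [Matrix.mulVec, dotProduct, Fin.sum_univ_four] using h2 a
    have h5 := congrArg (E⁻¹ *ᵥ ·) h4
    simp only [Matrix.mulVec_mulVec, hE.frame.inv_mul, Matrix.one_mulVec, Matrix.mulVec_zero] at h5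
    simpa using congrFun h5 0
  obtain ⟨a, ha⟩ := hne
  have hWo : IsOpen (V ∩ k a ⁻¹' {0}ᶜ) :=
    (hk a).continuousOn.isOpen_inter_preimage hJ.region.metric.isOpen isOpen_compl_singleton
  exact ⟨V ∩ k a ⁻¹' {0}ᶜ, hWo, ⟨hyV, ha⟩, Set.inter_subset_left.trans hVU, k,
    (hJ.mono hWo Set.inter_subset_left).isKundtField fun z hz => ⟨a, hz.2⟩⟩

end IsYangRegion

/-- Nondegeneracy of the chart components comes from the pseudo-orthonormal eigenbasis in the Segré
condition. -/
theorem LorentzMetric.isYangRegion {M : Type*} [TopologicalSpace M] [ChartedSpace Coord M]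
    (g : LorentzMetric M) (hYang : g.IsYangPureSpace) (hR : g.IsScalarFlat)
    (hSegre : g.HasSegreType) {e : OpenPartialHomeomorph M Coord}
    (he : e ∈ IsManifold.maximalAtlas (𝓡 4) ∞ M) : IsYangRegion (g.inChart e) e.target where
  metric :=
    { isOpen := e.open_target
      smooth := g.smooth e he
      symm := fun y _ => by
        ext a b
        exact g.symm _ _ _
      det_ne := fun y hy => by
        obtain ⟨-, E, ρ, hE⟩ := exists_isSegreFrame (hSegre e he y hy) (hR e he y hy)
        exact hE.frame.metric_det_ne }
  yang := hYang e he
  scalar := hR e he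
  segre := hSegre e he

end YangPure

end

theorem mainTheorem6 {M : Type*} [TopologicalSpace M] [ChartedSpace YangPure.Coord M]
    [IsManifold (𝓡 4) ∞ M] (g : YangPure.LorentzMetric M)
    (hYang : g.IsYangPureSpace) (hR : g.IsScalarFlat) (hSegre : g.HasSegreType) :
    (g.EnergyCondition → g.IsNonNullEinsteinMaxwell) ∧
      g.SatisfiesRainichConditions ∧ g.IsConformallyFlat ∧ g.IsKundt := by
  have h := fun e he => g.isYangRegion hYang hR hSegre (e := e) he
  exact ⟨fun hen e he y hy => (h e he).exists_einsteinMaxwell hy (hen e he y hy),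
    ⟨fun e he y hy => (h e he).rainichAlgebraicAt hy,
      fun e he y hy => (h e he).rainichAnalyticAt hy⟩,
    fun e he y hy => (h e he).weyl_eq_zero hy, fun e he y hy => (h e he).exists_kundt hy⟩
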